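/- An instance $\mathcal I=(G,c,R)$ of the Steiner Tree problem consists of a finite undirected graph $G=(V,E)$, positive edge costs $c\colon E\to\mathbb R_{>0}$, and a set $R\subseteq V$ of at least two terminals that all lie in one connected component of $G$. Fix for every instance an arbitrary root $r\in R$. Let $\mathrm{OPT}(\mathcal I)$ be the minimum of $c(T)=\sum_{e\in T}c(e)$ over all trees $T$ in $G$ that contain all vertices of $R$. Let $\mathrm{TMST}(\mathcal I)$ be the minimum cost of a spanning tree of the complete graph on $R$, where the edge $\{s,t\}$ costs the length of a shortest $s$-$t$ path in $(G,c)$. The instance is MST-optimal if $\mathrm{TMST}(\mathcal I)=\mathrm{OPT}(\mathcal I)$. Let $\vec E$ contain the two orientations $(u,v)$ and $(v,u)$, each of cost $c(\{u,v\})$, of every edge $\{u,v\}\in E$. The value $\mathrm{BCR}(\mathcal I)$ of the Bidirected Cut Relaxation is the minimum of $\sum_{e\in\vec E}c(e)\,x_e$ over all $x\in\mathbb R_{\ge 0}^{\vec E}$ such that $\sum_{(v,w)\in\vec E:\ v\in S,\ w\notin S}x_{(v,w)}\ge 1$ for all $S\subseteq V\setminus\{r\}$ with $S\cap R\ne\emptyset$.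 For $X\subseteq R$ let $\mathrm{cost}(X)$ be the minimum cost of a set $K\subseteq E$ such that all vertices of $X$ belong to the same connected component of $(V,K)$, and let $\vec{\mathcal X}=\{(X,v)\colon X\subseteq R,\ v\in X\}$. The value $\mathrm{HYP}(\mathcal I)$ of the Hypergraphic Relaxation is the minimum of $\sum_{(X,v)\in\vec{\mathcal X}}\mathrm{cost}(X)\,x_{(X,v)}$ over all $x\in\mathbb R_{\ge 0}^{\vec{\mathcal X}}$ such that $\sum_{(X,v)\in\vec{\mathcal X}:\ X\cap S\ne\emptyset,\ v\notin S}x_{(X,v)}\ge 1$ for all $\emptyset\ne S\subseteq R\setminus\{r\}$. Then, for every such choice of roots, $$\sup\left\{\frac{\mathrm{HYP}(\mathcal I)}{\mathrm{BCR}(\mathcal I)}\colon \mathcal I\text{ instance of Steiner Tree}\right\}=\sup\left\{\frac{\mathrm{OPT}(\mathcal I)}{\mathrm{BCR}(\mathcal I)}\colon \mathcal I\text{ MST-optimal instance of Steiner Tree}\right\}.$$ -/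

import Mathlib

noncomputable section

/-- An instance of the Steiner Tree problem: a finite undirected graph with positive edge costs
and a set of terminals. The terminals lie in one connected component (a Steiner tree exists), and
there are at least two of them (otherwise all values below are `0` and ratios are `0 / 0`).
Only the costs of edges of the graph are ever used. -/
structure SteinerInstance where
  V : Type
  [fintypeV : Fintype V]
  graph : SimpleGraph V
  cost : Sym2 V → ℝ
  cost_pos : ∀ e ∈ graph.edgeSet, 0 < cost e
  terminals : Finset V
  two_le_card : 2 ≤ terminals.card
  terminals_reachable : ∀ s ∈ terminals, ∀ t ∈ terminals, graph.Reachable s t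

attribute [instance] SteinerInstance.fintypeV

namespace SteinerInstance

variable (I : SteinerInstance)

open scoped Classical in
/-- The total cost `c(F)` of a set `F` of edges. -/
def edgeCost (F : Set (Sym2 I.V)) : ℝ :=
  ∑ e : Sym2 I.V with e ∈ F, I.cost e

/-! ### Steiner trees -/

/-- A Steiner tree: a subgraph of the given graph that is a tree and contains all terminals. -/
def IsSteinerTree (T : I.graph.Subgraph) : Prop :=
  T.coe.IsTree ∧ ∀ t ∈ I.terminals, t ∈ T.verts

/-- `OPT`: the cost of a cheapest Steiner tree. -/
def opt : ℝ :=
  sInf {q : ℝ | ∃ T : I.graph.Subgraph, I.IsSteinerTree T ∧ q = I.edgeCost T.edgeSet}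

/-! ### Terminal minimum spanning trees -/

/-- The cost of a walk: the sum of the costs of the edges it traverses. -/
def walkCost {u v : I.V} (p : I.graph.Walk u v) : ℝ :=
  (p.edges.map I.cost).sum

/-- The shortest-path distance, i.e. the cost of the edge between `u` and `v` in the metric
closure (used only for vertices that are connected by a walk). -/
def dist (u v : I.V) : ℝ :=
  sInf {q : ℝ | ∃ p : I.graph.Walk u v, q = I.walkCost p}

theorem dist_comm (u v : I.V) : I.dist u v = I.dist v u := by
  have h : ∀ a b : I.V, {q : ℝ | ∃ p : I.graph.Walk a b, q = I.walkCost p} ⊆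
      {q : ℝ | ∃ p : I.graph.Walk b a, q = I.walkCost p} := by
    rintro a b q ⟨p, rfl⟩
    exact ⟨p.reverse, by simp [walkCost]⟩
  unfold dist
  rw [Set.Subset.antisymm (h u v) (h v u)]

/-- The cost of an edge of the complete graph on the terminals, in the metric closure. -/
def terminalEdgeCost (e : Sym2 I.terminals) : ℝ :=
  Sym2.lift ⟨fun s t : I.terminals => I.dist s t, fun s t => I.dist_comm s t⟩ e

open scoped Classical in
/-- `TMST`: the cost of a minimum spanning tree of the complete graph on the terminals, in the
metric closure. -/
def tmst : ℝ :=
  sInf {q : ℝ | ∃ T : SimpleGraph I.terminals, T.IsTree ∧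
    q = ∑ e : Sym2 I.terminals with e ∈ T.edgeSet, I.terminalEdgeCost e}

/-- An instance is MST-optimal if a terminal MST is a cheapest Steiner tree. -/
def MSTOptimal : Prop := I.tmst = I.opt

/-! ### The Bidirected Cut Relaxation -/

open scoped Classical in
/-- Feasible solutions of the Bidirected Cut Relaxation with root `r`. The darts of the graph are
its bidirected edges: each undirected edge, in each of its two orientations. -/
def BCRFeasible (r : I.V) (x : I.graph.Dart → ℝ) : Prop :=
  (∀ d, 0 ≤ x d) ∧
  ∀ S : Finset I.V, r ∉ S → (S ∩ I.terminals).Nonempty →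
    1 ≤ ∑ d : I.graph.Dart with d.fst ∈ S ∧ d.snd ∉ S, x d

open scoped Classical in
/-- The value of the Bidirected Cut Relaxation with root `r`. -/
def bcr (r : I.V) : ℝ :=
  sInf {q : ℝ | ∃ x : I.graph.Dart → ℝ, I.BCRFeasible r x ∧
    q = ∑ d : I.graph.Dart, I.cost d.edge * x d}

/-! ### The Hypergraphic Relaxation -/

/-- The set of edges `K` is a component connecting `X`: it consists of edges of the graph, and all
vertices of `X` belong to the same connected component of `(V, K)`. -/
def IsComponentConnecting (K : Set (Sym2 I.V)) (X : Finset I.V) : Prop :=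
  K ⊆ I.graph.edgeSet ∧
    ∀ u ∈ X, ∀ v ∈ X, (SimpleGraph.fromEdgeSet K).Reachable u v

/-- The cost of a cheapest component connecting `X`. -/
def connectCost (X : Finset I.V) : ℝ :=
  sInf {q : ℝ | ∃ K : Set (Sym2 I.V), I.IsComponentConnecting K X ∧ q = I.edgeCost K}

open scoped Classical in
/-- The directed components `(X, v)` with `X ⊆ R` and `v ∈ X`. -/
def directedComponents : Finset (Finset I.V × I.V) :=
  {p ∈ I.terminals.powerset ×ˢ I.terminals | p.2 ∈ p.1}

open scoped Classical in
/-- The directed components that leave the set `S`. -/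
def leaving (S : Finset I.V) : Finset (Finset I.V × I.V) :=
  {p ∈ I.directedComponents | (p.1 ∩ S).Nonempty ∧ p.2 ∉ S}

/-- Feasible solutions of the Hypergraphic Relaxation with root `r`. Only the values of `x` on
directed components matter. -/
def HypFeasible (r : I.V) (x : Finset I.V × I.V → ℝ) : Prop :=
  (∀ p ∈ I.directedComponents, 0 ≤ x p) ∧
  ∀ S : Finset I.V, S.Nonempty → S ⊆ I.terminals → r ∉ S → 1 ≤ ∑ p ∈ I.leaving S, x p

/-- The value of the Hypergraphic Relaxation with root `r`. -/
def hyp (r : I.V) : ℝ :=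
  sInf {q : ℝ | ∃ x : Finset I.V × I.V → ℝ, I.HypFeasible r x ∧
    q = ∑ p ∈ I.directedComponents, I.connectCost p.1 * x p}

end SteinerInstance

end

/-!
If an instance is MST-optimal, then a component connecting `X` costs at least as much as a terminal
minimum spanning tree saves once `X` is contracted, since completing the component greedily yields
a Steiner tree (`opt_le_add_sum`). Following Kruskal's algorithm, these savings, weighted by a
feasible solution of the hypergraphic relaxation, add up to at least the cost of a terminal minimum
spanning tree: at each distance threshold the components have to merge all classes of terminals
(`numClasses_sub_one_le`, `excess_le_sum_excess_sub`). Hence `OPT ≤ HYP` (`MSTOptimal.opt_le_hyp`).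

Conversely, given any instance, consider a dual solution `y` of the hypergraphic relaxation, i.e. a
weighting of the sets of terminals without the root. By linear programming duality and uncrossing
it can be taken laminar and of value (almost) `HYP` (`exists_isLaminar_isHypDual_pos`). Add an edge
between any two terminals `u`, `v`, whose cost is the larger of the weights of the sets separating
`u` from `v` and `v` from `u`. These edges are expensive enough for `y` to remain feasible
(`load_le_augmented`), so `OPT` is at least the value of `y`; by laminarity they are cheap enough
for a terminal spanning tree of this cost to exist (`tmst_augment_le_sum`). So the new instance is
MST-optimal and its `OPT` is the value of `y`. Adding edges, none of them at a higher cost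
than an edge of the graph with the same ends, does not increase `BCR` (`bcr_augment_le`).

The root prescribed for the new instance may be another one, but `BCR` does not depend on the root
(`bcr_le_bcr_of_root`): a feasible solution for the root `r` supports a unit flow from `r'` to `r`
by max-flow min-cut, and reversing this flow moves the root to `r'`.
-/

/-! ### Duality for covering linear programs -/

open Filter Topology in
/-- The values `(a, b)` for which the packing problem with capacities `a` has a solution of value
at least `b` form a closed set: since `A` is nonnegative without zero rows, the capacities bound
all solutions. -/
theorem isClosed_packing_values {ι κ : Type*} [Fintype ι] [Fintype κ] (A : ι → κ → ℝ)
    (hA : ∀ i j, 0 ≤ A i j) (hrow : ∀ i, ∃ j, 0 < A i j) :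
    IsClosed {p : (κ → ℝ) × ℝ | ∃ y : ι → ℝ, (∀ i, 0 ≤ y i) ∧
      (∀ j, ∑ i, A i j * y i ≤ p.1 j) ∧ p.2 ≤ ∑ i, y i} := by
  apply IsSeqClosed.isClosed
  intro p q hp hpq
  choose y hy0 hyA hyb using hp
  have hp1 : ∀ j, Tendsto (fun n => (p n).1 j) atTop (𝓝 (q.1 j)) := fun j =>
    ((continuous_apply j).comp continuous_fst).continuousAt.tendsto.comp hpq
  have hp2 : Tendsto (fun n => (p n).2) atTop (𝓝 q.2) :=
    continuous_snd.continuousAt.tendsto.comp hpq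
  choose B hB using fun j => (hp1 j).bddAbove_range
  choose j hj using hrow
  have hmem : ∀ n, y n ∈ Set.Icc (0 : ι → ℝ) (fun i => B (j i) / A i (j i)) := by
    intro n
    refine ⟨fun i => hy0 n i, fun i => ?_⟩
    rw [le_div_iff₀ (hj i)]
    calc y n i * A i (j i) = A i (j i) * y n i := mul_comm _ _
      _ ≤ ∑ i', A i' (j i) * y n i' :=
          Finset.single_le_sum (f := fun i' => A i' (j i) * y n i')
            (fun i' _ => mul_nonneg (hA _ _) (hy0 n i')) (Finset.mem_univ i)
      _ ≤ (p n).1 (j i) := hyA n _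
      _ ≤ B (j i) := hB (j i) ⟨n, rfl⟩
  obtain ⟨z, hz, φ, hφ, hlim⟩ := isCompact_Icc.tendsto_subseq hmem
  have hcoord : ∀ i, Tendsto (fun n => y (φ n) i) atTop (𝓝 (z i)) := fun i =>
    (continuous_apply i).continuousAt.tendsto.comp hlim
  refine ⟨z, fun i => hz.1 i, fun k => ?_, ?_⟩
  · refine le_of_tendsto_of_tendsto'
      (tendsto_finsetSum _ fun i _ => (hcoord i).const_mul (A i k))
      ((hp1 k).comp hφ.tendsto_atTop) fun n => hyA (φ n) k
  · exact le_of_tendsto_of_tendsto' (hp2.comp hφ.tendsto_atTop)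
      (tendsto_finsetSum _ fun i _ => hcoord i) fun n => hyb (φ n)

/-- Strong duality for covering problems: a lower bound `γ` on the value of the covering problem
is attained by a solution of the dual packing problem. -/
theorem exists_packing_of_covering_bound {ι κ : Type*} [Fintype ι] [Fintype κ] (A : ι → κ → ℝ)
    (hA : ∀ i j, 0 ≤ A i j) (hrow : ∀ i, ∃ j, 0 < A i j) (c : κ → ℝ) (hc : ∀ j, 0 ≤ c j) (γ : ℝ)
    (h : ∀ x : κ → ℝ, (∀ j, 0 ≤ x j) → (∀ i, 1 ≤ ∑ j, A i j * x j) → γ ≤ ∑ j, c j * x j) :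
    ∃ y : ι → ℝ, (∀ i, 0 ≤ y i) ∧ (∀ j, ∑ i, A i j * y i ≤ c j) ∧ γ ≤ ∑ i, y i := by
  classical
  by_contra hcon
  set W : Set ((κ → ℝ) × ℝ) := {p | ∃ y : ι → ℝ, (∀ i, 0 ≤ y i) ∧
      (∀ j, ∑ i, A i j * y i ≤ p.1 j) ∧ p.2 ≤ ∑ i, y i} with hW
  have hclosed : IsClosed W := isClosed_packing_values A hA hrow
  have hsmul : ∀ (t : ℝ), 0 ≤ t → ∀ p ∈ W, t • p ∈ W := by
    rintro t ht p ⟨y, h0, h1, h2⟩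
    refine ⟨fun i => t * y i, fun i => mul_nonneg ht (h0 i), fun j => ?_, ?_⟩
    · calc ∑ i, A i j * (t * y i) = t * ∑ i, A i j * y i := by
            rw [Finset.mul_sum]; exact Finset.sum_congr rfl fun i _ => by ring
        _ ≤ t * p.1 j := mul_le_mul_of_nonneg_left (h1 j) ht
    · rw [← Finset.mul_sum]
      exact mul_le_mul_of_nonneg_left h2 ht
  have hadd : ∀ p ∈ W, ∀ q ∈ W, p + q ∈ W := by
    rintro p ⟨y, h0, h1, h2⟩ q ⟨z, h0', h1', h2'⟩
    refine ⟨fun i => y i + z i, fun i => add_nonneg (h0 i) (h0' i), fun j => ?_, ?_⟩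
    · simp only [mul_add, Finset.sum_add_distrib]
      exact add_le_add (h1 j) (h1' j)
    · simp only [Finset.sum_add_distrib]
      exact add_le_add h2 h2'
  have hconv : Convex ℝ W := fun p hp q hq a b ha hb _ =>
    hadd _ (hsmul a ha p hp) _ (hsmul b hb q hq)
  have hnot : (c, γ) ∉ W := hcon
  obtain ⟨f, u, hfu, hux⟩ := geometric_hahn_banach_closed_point hconv hclosed hnot
  have hzero : (0 : (κ → ℝ) × ℝ) ∈ W := ⟨0, by simp⟩
  have hu : 0 < u := by simpa using hfu 0 hzero
  have hneg : ∀ p ∈ W, f p ≤ 0 := by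
    intro p hp
    by_contra! hpos
    have := hfu _ (hsmul (u / f p) (by positivity) p hp)
    rw [map_smul, smul_eq_mul, div_mul_cancel₀ _ hpos.ne'] at this
    exact lt_irrefl _ this
  have hexp : ∀ (a : κ → ℝ) (b : ℝ),
      f (a, b) = ∑ j, a j * f (Pi.single j 1, 0) + b * f (0, 1) := by
    intro a b
    have : ((a, b) : (κ → ℝ) × ℝ) =
        ∑ j, a j • ((Pi.single j 1 : κ → ℝ), (0 : ℝ)) + b • ((0 : κ → ℝ), (1 : ℝ)) := by
      refine Prod.ext ?_ ?_
      · simp only [Prod.fst_add, Prod.fst_sum, Prod.smul_fst, smul_zero, add_zero]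
        ext k
        simp [Finset.sum_apply, Pi.single_apply]
      · simp [Prod.snd_sum]
    rw [this, map_add, map_sum]
    simp only [map_smul, smul_eq_mul]
  set x : κ → ℝ := fun j => -f (Pi.single j 1, 0) with hx
  set g : ℝ := f (0, 1) with hg
  have hexp' : ∀ (a : κ → ℝ) (b : ℝ), f (a, b) = -∑ j, a j * x j + b * g := by
    intro a b
    rw [hexp a b, hx]
    simp
  have hx0 : ∀ j, 0 ≤ x j := by
    intro j
    have : ((Pi.single j 1 : κ → ℝ), (0 : ℝ)) ∈ W :=
      ⟨0, by simp, fun k => by simp [Pi.single_apply]; split_ifs <;> norm_num, by simp⟩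
    simpa [hx] using hneg _ this
  have hg0 : 0 ≤ g := by
    have := hneg ((0 : κ → ℝ), (-1 : ℝ)) ⟨0, by simp⟩
    rw [hexp'] at this
    simpa using this
  have hrowx : ∀ i, g ≤ ∑ j, A i j * x j := by
    intro i
    have := hneg (A i, 1) ⟨Pi.single i 1, fun k => by
      simp [Pi.single_apply]; split_ifs <;> norm_num, fun j => by simp [Pi.single_apply],
      by simp⟩
    rw [hexp'] at this
    linarith
  have hfx : ∑ j, c j * x j < γ * g := by
    have := hu.trans hux
    rw [hexp'] at this
    linarith
  have hcx : 0 ≤ ∑ j, c j * x j := Finset.sum_nonneg fun j _ => mul_nonneg (hc j) (hx0 j)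
  have hgpos : 0 < g := by
    rcases hg0.eq_or_lt with h0 | h0
    · rw [← h0, mul_zero] at hfx
      exact absurd hfx hcx.not_gt
    · exact h0
  have := h (fun j => x j / g) (fun j => div_nonneg (hx0 j) hg0) fun i => by
    simp only [mul_div_assoc', ← Finset.sum_div]
    rw [le_div_iff₀ hgpos, one_mul]
    exact hrowx i
  simp only [mul_div_assoc', ← Finset.sum_div] at this
  rw [le_div_iff₀ hgpos] at this
  exact absurd hfx this.not_gt

/-! ### Partitions generated by edge sets -/

/-- The partition of the vertices into the connected components of the graph `(V, K)`. -/
def joins {α : Type*} (K : Set (Sym2 α)) : Setoid α :=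
  (SimpleGraph.fromEdgeSet K).reachableSetoid

/-- The partition whose only nontrivial class is `X`. -/
def clump {α : Type*} (X : Set α) : Setoid α where
  r u v := u = v ∨ (u ∈ X ∧ v ∈ X)
  iseqv := ⟨fun _ => Or.inl rfl, by rintro u v (rfl | ⟨h, h'⟩) <;> simp_all,
    by rintro u v w (rfl | ⟨h, h'⟩) (rfl | ⟨k, k'⟩) <;> simp_all⟩

theorem joins_rel_iff {α : Type*} {K : Set (Sym2 α)} {u v : α} :
    joins K u v ↔ (SimpleGraph.fromEdgeSet K).Reachable u v := Iff.rfl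

theorem clump_le_iff {α : Type*} {X : Set α} {s : Setoid α} :
    clump X ≤ s ↔ ∀ u ∈ X, ∀ v ∈ X, s u v := by
  constructor
  · intro h u hu v hv
    exact h (Or.inr ⟨hu, hv⟩)
  · rintro h u v (rfl | ⟨hu, hv⟩)
    · exact s.refl' _
    · exact h u hu v hv

theorem clump_pair_le_iff {α : Type*} {a b : α} {s : Setoid α} :
    clump {a, b} ≤ s ↔ s a b := by
  rw [clump_le_iff]
  constructor
  · intro h
    exact h a (by simp) b (by simp)
  · rintro h u (rfl | rfl) v (rfl | rfl)
    exacts [s.refl' _, h, s.symm' h, s.refl' _]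

theorem SimpleGraph.Reachable.setoid_rel {α : Type*} {G : SimpleGraph α} {s : Setoid α}
    (h : ∀ u v, G.Adj u v → s u v) {u v : α} (huv : G.Reachable u v) : s u v := by
  obtain ⟨p⟩ := huv
  induction p with
  | nil => exact s.refl' _
  | cons hadj _ ih => exact s.trans' (h _ _ hadj) ih

theorem joins_rel_of_mem {α : Type*} {K : Set (Sym2 α)} {u v : α} (h : s(u, v) ∈ K) :
    joins K u v := by
  by_cases huv : u = v
  · subst huv
    exact (joins K).refl' _
  · exact SimpleGraph.Adj.reachable ((SimpleGraph.fromEdgeSet_adj K).2 ⟨h, huv⟩)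

theorem joins_le_iff {α : Type*} {K : Set (Sym2 α)} {s : Setoid α} :
    joins K ≤ s ↔ ∀ u v, s(u, v) ∈ K → s u v := by
  constructor
  · intro h u v huv
    exact h (joins_rel_of_mem huv)
  · intro h u v huv
    exact SimpleGraph.Reachable.setoid_rel
      (fun a b hab => h a b ((SimpleGraph.fromEdgeSet_adj K).1 hab).1) huv

theorem joins_mono {α : Type*} {K L : Set (Sym2 α)} (h : K ⊆ L) : joins K ≤ joins L :=
  joins_le_iff.2 fun _ _ huv => joins_rel_of_mem (h huv)

theorem sup_clump_pair_rel_iff {α : Type*} {s : Setoid α} {a b u v : α} :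
    (s ⊔ clump {a, b}) u v ↔ s u v ∨ (s u a ∧ s b v) ∨ (s u b ∧ s a v) := by
  let t : Setoid α :=
    { r := fun u v => s u v ∨ (s u a ∧ s b v) ∨ (s u b ∧ s a v)
      iseqv := by
        refine ⟨fun x => Or.inl (s.refl' x), fun {x y} h => ?_, fun {x y z} h k => ?_⟩
        · rcases h with h | ⟨h, h'⟩ | ⟨h, h'⟩
          · exact Or.inl (s.symm' h)
          · exact Or.inr (Or.inr ⟨s.symm' h', s.symm' h⟩)
          · exact Or.inr (Or.inl ⟨s.symm' h', s.symm' h⟩)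
        · rcases h with h | ⟨h, h'⟩ | ⟨h, h'⟩ <;> rcases k with k | ⟨k, k'⟩ | ⟨k, k'⟩
          · exact Or.inl (s.trans' h k)
          · exact Or.inr (Or.inl ⟨s.trans' h k, k'⟩)
          · exact Or.inr (Or.inr ⟨s.trans' h k, k'⟩)
          · exact Or.inr (Or.inl ⟨h, s.trans' h' k⟩)
          · exact Or.inr (Or.inl ⟨h, k'⟩)
          · exact Or.inl (s.trans' h k')
          · exact Or.inr (Or.inr ⟨h, s.trans' h' k⟩)
          · exact Or.inl (s.trans' h k')
          · exact Or.inr (Or.inr ⟨h, k'⟩) }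
  constructor
  · intro h
    have hle : s ⊔ clump {a, b} ≤ t := sup_le (fun {x y} hxy => Or.inl hxy)
      (clump_pair_le_iff.2 (Or.inr (Or.inl ⟨s.refl' _, s.refl' _⟩)))
    exact hle h
  · have hs : s ≤ s ⊔ clump {a, b} := le_sup_left
    have hab : (s ⊔ clump {a, b}) a b := clump_pair_le_iff.1 le_sup_right
    rintro (h | ⟨h, h'⟩ | ⟨h, h'⟩)
    · exact hs h
    · exact Setoid.trans' _ (hs h) (Setoid.trans' _ hab (hs h'))
    · exact Setoid.trans' _ (hs h) (Setoid.trans' _ (Setoid.symm' _ hab) (hs h'))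

theorem joins_insert {α : Type*} (K : Set (Sym2 α)) (a b : α) :
    joins (insert s(a, b) K) = joins K ⊔ clump {a, b} := by
  apply le_antisymm
  · rw [joins_le_iff]
    intro u v huv
    rcases Set.mem_insert_iff.1 huv with h | h
    · rw [Sym2.eq_iff] at h
      have hab : (joins K ⊔ clump {a, b}) a b := clump_pair_le_iff.1 le_sup_right
      rcases h with ⟨rfl, rfl⟩ | ⟨rfl, rfl⟩
      · exact hab
      · exact Setoid.symm' _ hab
    · exact (le_sup_left : joins K ≤ _) (joins_rel_of_mem h)
  · refine sup_le (joins_mono (Set.subset_insert _ _)) (clump_pair_le_iff.2 ?_)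
    exact joins_rel_of_mem (Set.mem_insert _ _)

namespace SteinerInstance

variable (I : SteinerInstance)

/-! ### Costs of edge sets, Steiner trees and terminal spanning trees -/

open scoped Classical in
theorem edgeCost_eq_sum_ite (F : Set (Sym2 I.V)) :
    I.edgeCost F = ∑ e : Sym2 I.V, if e ∈ F then I.cost e else 0 := by
  rw [edgeCost, Finset.sum_filter]

theorem edgeCost_mono {F K : Set (Sym2 I.V)} (hFK : F ⊆ K) (hK : K ⊆ I.graph.edgeSet) :
    I.edgeCost F ≤ I.edgeCost K := by
  classical
  rw [edgeCost_eq_sum_ite, edgeCost_eq_sum_ite]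
  refine Finset.sum_le_sum fun e _ => ?_
  by_cases hF : e ∈ F
  · simp [hF, hFK hF]
  · by_cases hK' : e ∈ K
    · simp [hF, hK', (I.cost_pos e (hK hK')).le]
    · simp [hF, hK']

@[simp]
theorem edgeCost_empty : I.edgeCost ∅ = 0 := by
  simp [edgeCost]

theorem edgeCost_nonneg {K : Set (Sym2 I.V)} (hK : K ⊆ I.graph.edgeSet) : 0 ≤ I.edgeCost K := by
  simpa using I.edgeCost_mono (Set.empty_subset K) hK

theorem edgeCost_union_of_disjoint {K L : Set (Sym2 I.V)} (h : Disjoint K L) :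
    I.edgeCost (K ∪ L) = I.edgeCost K + I.edgeCost L := by
  classical
  simp only [edgeCost_eq_sum_ite, ← Finset.sum_add_distrib]
  refine Finset.sum_congr rfl fun e _ => ?_
  by_cases hK : e ∈ K
  · simp [hK, Set.disjoint_left.1 h hK]
  · simp [hK]

theorem edgeCost_union_le {K L : Set (Sym2 I.V)} (hL : L ⊆ I.graph.edgeSet) :
    I.edgeCost (K ∪ L) ≤ I.edgeCost K + I.edgeCost L := by
  have : K ∪ L = K ∪ (L \ K) := by simp
  rw [this, edgeCost_union_of_disjoint _ Set.disjoint_sdiff_right]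
  gcongr
  exact I.edgeCost_mono Set.sdiff_subset hL

theorem edgeCost_biUnion_le {ι : Type*} (s : Finset ι) (K : ι → Set (Sym2 I.V))
    (hK : ∀ i ∈ s, K i ⊆ I.graph.edgeSet) :
    I.edgeCost (⋃ i ∈ s, K i) ≤ ∑ i ∈ s, I.edgeCost (K i) := by
  classical
  induction s using Finset.induction_on with
  | empty => simp
  | insert a s ha ih =>
    rw [Finset.set_biUnion_insert, Finset.sum_insert ha]
    have hs : ∀ i ∈ s, K i ⊆ I.graph.edgeSet := fun i hi => hK i (Finset.mem_insert_of_mem hi)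
    refine (I.edgeCost_union_le (Set.iUnion₂_subset hs)).trans ?_
    gcongr
    exact ih hs

theorem le_edgeCost_of_mem {K : Set (Sym2 I.V)} (hK : K ⊆ I.graph.edgeSet) {e : Sym2 I.V}
    (he : e ∈ K) : I.cost e ≤ I.edgeCost K := by
  classical
  have : I.edgeCost {e} = I.cost e := by simp [edgeCost_eq_sum_ite]
  rw [← this]
  exact I.edgeCost_mono (Set.singleton_subset_iff.2 he) hK

theorem exists_mem_terminals_ne (r : I.V) : ∃ t ∈ I.terminals, t ≠ r :=
  Finset.exists_mem_ne (by have := I.two_le_card; omega) r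

/-- All edges cost at least some positive constant. -/
theorem exists_pos_le_cost : ∃ m : ℝ, 0 < m ∧ ∀ e ∈ I.graph.edgeSet, m ≤ I.cost e := by
  classical
  by_cases h : I.graph.edgeSet.Nonempty
  · obtain ⟨e, he, hmin⟩ := Set.exists_min_image _ I.cost (Set.toFinite I.graph.edgeSet) h
    exact ⟨I.cost e, I.cost_pos e he, hmin⟩
  · exact ⟨1, one_pos, fun e he => absurd ⟨e, he⟩ h⟩

theorem isComponentConnecting_edgeSet {X : Finset I.V} (hX : X ⊆ I.terminals) :
    I.IsComponentConnecting I.graph.edgeSet X := by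
  refine ⟨subset_rfl, fun u hu v hv => ?_⟩
  rw [SimpleGraph.fromEdgeSet_edgeSet]
  exact I.terminals_reachable u (hX hu) v (hX hv)

theorem connectCost_le {K : Set (Sym2 I.V)} {X : Finset I.V} (h : I.IsComponentConnecting K X) :
    I.connectCost X ≤ I.edgeCost K := by
  refine csInf_le ⟨0, ?_⟩ ⟨K, h, rfl⟩
  rintro q ⟨L, hL, rfl⟩
  exact I.edgeCost_nonneg hL.1

theorem le_connectCost {X : Finset I.V} (hX : X ⊆ I.terminals) {γ : ℝ}
    (h : ∀ K, I.IsComponentConnecting K X → γ ≤ I.edgeCost K) : γ ≤ I.connectCost X := by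
  refine le_csInf ⟨_, _, I.isComponentConnecting_edgeSet hX, rfl⟩ ?_
  rintro q ⟨K, hK, rfl⟩
  exact h K hK

theorem connectCost_nonneg {X : Finset I.V} (hX : X ⊆ I.terminals) : 0 ≤ I.connectCost X :=
  I.le_connectCost hX fun _ hK => I.edgeCost_nonneg hK.1

theorem exists_isSteinerTree {K : Set (Sym2 I.V)}
    (hK : I.IsComponentConnecting K I.terminals) :
    ∃ T : I.graph.Subgraph, I.IsSteinerTree T ∧ T.edgeSet ⊆ K := by
  classical
  obtain ⟨r, hr⟩ : I.terminals.Nonempty := Finset.card_pos.1 (by have := I.two_le_card; omega)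
  set H := SimpleGraph.fromEdgeSet K with hH
  obtain ⟨T, hTle, hT⟩ :=
    (H.connectedComponentMk r).connected_toSimpleGraph.exists_isTree_le
  have hadj : ∀ u v : (H.connectedComponentMk r), T.Adj u v → H.Adj u v := fun u v huv =>
    hTle huv
  have hHK : ∀ u v, H.Adj u v → s(u, v) ∈ K := fun u v huv =>
    ((SimpleGraph.fromEdgeSet_adj K).1 huv).1
  let T' : I.graph.Subgraph :=
    { verts := (H.connectedComponentMk r).supp
      Adj := fun u v => ∃ (hu : u ∈ (H.connectedComponentMk r).supp)
        (hv : v ∈ (H.connectedComponentMk r).supp), T.Adj ⟨u, hu⟩ ⟨v, hv⟩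
      adj_sub := by
        rintro u v ⟨hu, hv, huv⟩
        exact hK.1 (hHK _ _ (hadj _ _ huv))
      edge_vert := by
        rintro u v ⟨hu, hv, huv⟩
        exact hu
      symm := ⟨by
        rintro u v ⟨hu, hv, huv⟩
        exact ⟨hv, hu, huv.symm⟩⟩ }
  refine ⟨T', ⟨?_, fun t ht => ?_⟩, ?_⟩
  · have e : T'.coe ≃g T :=
      { toEquiv := Equiv.refl _
        map_rel_iff' := by
          intro a b
          exact ⟨fun h => ⟨a.2, b.2, h⟩, fun ⟨_, _, h⟩ => h⟩ }
    exact e.isTree_iff.2 hT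
  · change t ∈ (H.connectedComponentMk r).supp
    rw [SimpleGraph.ConnectedComponent.mem_supp_iff, SimpleGraph.ConnectedComponent.eq]
    exact hK.2 t ht r hr
  · intro e
    induction e with
    | _ u v =>
      rintro ⟨hu, hv, huv⟩
      exact hHK _ _ (hadj _ _ huv)

theorem IsSteinerTree.isComponentConnecting {T : I.graph.Subgraph} (hT : I.IsSteinerTree T) :
    I.IsComponentConnecting T.edgeSet I.terminals := by
  refine ⟨T.edgeSet_subset, fun u hu v hv => ?_⟩
  let f : T.coe →g SimpleGraph.fromEdgeSet T.edgeSet :=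
    { toFun := fun x => x.1
      map_rel' := by
        intro a b hab
        exact (SimpleGraph.fromEdgeSet_adj _).2 ⟨hab, (T.adj_sub hab).ne⟩ }
  exact (hT.1.connected ⟨u, hT.2 u hu⟩ ⟨v, hT.2 v hv⟩).map f

theorem opt_le_edgeCost {K : Set (Sym2 I.V)} (hK : I.IsComponentConnecting K I.terminals) :
    I.opt ≤ I.edgeCost K := by
  obtain ⟨T, hT, hTK⟩ := I.exists_isSteinerTree hK
  refine le_trans ?_ (I.edgeCost_mono hTK hK.1)
  refine csInf_le ⟨0, ?_⟩ ⟨T, hT, rfl⟩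
  rintro q ⟨L, _, rfl⟩
  exact I.edgeCost_nonneg L.edgeSet_subset

theorem le_opt {γ : ℝ}
    (h : ∀ K, I.IsComponentConnecting K I.terminals → γ ≤ I.edgeCost K) : γ ≤ I.opt := by
  obtain ⟨T, hT, -⟩ := I.exists_isSteinerTree (I.isComponentConnecting_edgeSet subset_rfl)
  refine le_csInf ⟨_, T, hT, rfl⟩ ?_
  rintro q ⟨T, hT, rfl⟩
  exact h _ (IsSteinerTree.isComponentConnecting I hT)

theorem walkCost_nonneg {u v : I.V} (p : I.graph.Walk u v) : 0 ≤ I.walkCost p := by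
  refine List.sum_nonneg fun q hq => ?_
  obtain ⟨e, he, rfl⟩ := List.mem_map.1 hq
  exact (I.cost_pos e (p.edges_subset_edgeSet he)).le

theorem dist_nonneg (u v : I.V) : 0 ≤ I.dist u v := by
  refine Real.sInf_nonneg ?_
  rintro q ⟨p, rfl⟩
  exact I.walkCost_nonneg p

theorem dist_le_cost {u v : I.V} (h : I.graph.Adj u v) : I.dist u v ≤ I.cost s(u, v) := by
  refine csInf_le ⟨0, ?_⟩ ⟨h.toWalk, by simp [walkCost]⟩
  rintro q ⟨p, rfl⟩
  exact I.walkCost_nonneg p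

theorem edgeCost_le_walkCost {u v : I.V} (p : I.graph.Walk u v) :
    I.edgeCost {e | e ∈ p.edges} ≤ I.walkCost p := by
  classical
  induction p with
  | nil => simp [walkCost]
  | @cons a b c h p ih =>
    have hset : {e | e ∈ (SimpleGraph.Walk.cons h p).edges} =
        {s(a, b)} ∪ {e | e ∈ p.edges} := by
      ext e; simp
    have hone : I.edgeCost {s(a, b)} = I.cost s(a, b) := by simp [edgeCost_eq_sum_ite]
    rw [hset]
    refine (I.edgeCost_union_le fun e he => p.edges_subset_edgeSet he).trans ?_
    rw [hone]
    have hcost : I.walkCost (SimpleGraph.Walk.cons h p) = I.cost s(a, b) + I.walkCost p := by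
      simp [walkCost]
    rw [hcost]
    exact add_le_add le_rfl ih

theorem joins_walk_edges {u v : I.V} (p : I.graph.Walk u v) : joins {e | e ∈ p.edges} u v := by
  induction p with
  | nil => exact Setoid.refl' _ _
  | @cons a b c h p ih =>
    refine Setoid.trans' _ (joins_rel_of_mem (v := b) (by simp)) (joins_mono ?_ ih)
    intro e he
    simp only [Set.mem_ofPred_eq, SimpleGraph.Walk.edges_cons, List.mem_cons] at he ⊢
    exact Or.inr he

theorem exists_connecting_edgeCost_le_dist {u v : I.V} (h : I.graph.Reachable u v) :
    ∃ K ⊆ I.graph.edgeSet, joins K u v ∧ I.edgeCost K ≤ I.dist u v := by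
  classical
  obtain ⟨p₀⟩ := h
  obtain ⟨K, ⟨hK, hj⟩, hmin⟩ := Set.exists_min_image
    {K : Set (Sym2 I.V) | K ⊆ I.graph.edgeSet ∧ joins K u v} I.edgeCost (Set.toFinite _)
    ⟨_, fun e he => p₀.edges_subset_edgeSet he, I.joins_walk_edges p₀⟩
  refine ⟨K, hK, hj, le_csInf ⟨_, p₀, rfl⟩ ?_⟩
  rintro q ⟨p, rfl⟩
  exact (hmin _ ⟨fun e he => p.edges_subset_edgeSet he, I.joins_walk_edges p⟩).trans
    (I.edgeCost_le_walkCost p)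

theorem terminalEdgeCost_nonneg (e : Sym2 I.terminals) : 0 ≤ I.terminalEdgeCost e := by
  induction e with
  | _ s t => exact I.dist_nonneg s t

/-- A component for `X`, completed by shortest paths between terminals, yields a Steiner tree. -/
theorem opt_le_add_sum {K : Set (Sym2 I.V)} (hK : K ⊆ I.graph.edgeSet) {X : Set I.terminals}
    (hX : ∀ u ∈ X, ∀ v ∈ X, joins K u v) (F : Finset (Sym2 I.terminals))
    (hF : clump X ⊔ joins (F : Set (Sym2 I.terminals)) = ⊤) :
    I.opt ≤ I.edgeCost K + ∑ e ∈ F, I.terminalEdgeCost e := by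
  classical
  have hex : ∀ e : Sym2 I.terminals, ∃ L ⊆ I.graph.edgeSet,
      (∀ s t : I.terminals, e = s(s, t) → joins L s t) ∧
        I.edgeCost L ≤ I.terminalEdgeCost e := by
    intro e
    induction e with
    | _ s t =>
      obtain ⟨L, hL, hj, hc⟩ := I.exists_connecting_edgeCost_le_dist
        (I.terminals_reachable s s.2 t t.2)
      refine ⟨L, hL, fun s' t' h => ?_, hc⟩
      rcases Sym2.eq_iff.1 h with ⟨rfl, rfl⟩ | ⟨rfl, rfl⟩
      exacts [hj, Setoid.symm' _ hj]
  choose L hL hj hc using hex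
  have hU : (⋃ e ∈ F, L e) ⊆ I.graph.edgeSet := Set.iUnion₂_subset fun e _ => hL e
  have htop : (⊤ : Setoid I.terminals) ≤ (joins (K ∪ ⋃ e ∈ F, L e)).comap Subtype.val := by
    rw [← hF]
    refine sup_le (clump_le_iff.2 fun u hu v hv => ?_) (joins_le_iff.2 fun u v huv => ?_)
    · exact joins_mono Set.subset_union_left (hX u hu v hv)
    · refine joins_mono ?_ (hj _ u v rfl)
      exact (Set.subset_biUnion_of_mem (u := L) huv).trans Set.subset_union_right
  refine (I.opt_le_edgeCost ⟨Set.union_subset hK hU, fun u hu v hv => ?_⟩).trans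
    ((I.edgeCost_union_le hU).trans ?_)
  · exact htop (x := ⟨u, hu⟩) (y := ⟨v, hv⟩) trivial
  · gcongr
    exact (I.edgeCost_biUnion_le F L fun e _ => hL e).trans (Finset.sum_le_sum fun e _ => hc e)

theorem tmst_le_sum (F : Finset (Sym2 I.terminals))
    (hF : joins (F : Set (Sym2 I.terminals)) = ⊤) :
    I.tmst ≤ ∑ e ∈ F, I.terminalEdgeCost e := by
  classical
  obtain ⟨r, hr⟩ : I.terminals.Nonempty := Finset.card_pos.1 (by have := I.two_le_card; omega)
  have hconn : (SimpleGraph.fromEdgeSet (F : Set (Sym2 I.terminals))).Connected :=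
    { preconnected := fun u v => by
        have : joins (F : Set (Sym2 I.terminals)) u v := by rw [hF]; trivial
        exact this
      nonempty := ⟨⟨r, hr⟩⟩ }
  obtain ⟨T, hle, hT⟩ := hconn.exists_isTree_le
  have hle_tree : I.tmst ≤ ∑ e : Sym2 I.terminals with e ∈ T.edgeSet, I.terminalEdgeCost e := by
    refine csInf_le ⟨0, ?_⟩ ⟨T, hT, rfl⟩
    rintro q ⟨T, -, rfl⟩
    exact Finset.sum_nonneg fun e _ => I.terminalEdgeCost_nonneg e
  refine hle_tree.trans ?_
  refine Finset.sum_le_sum_of_subset_of_nonneg (fun e he => ?_)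
    fun e _ _ => I.terminalEdgeCost_nonneg e
  have he' : e ∈ T.edgeSet := by simpa using he
  have := SimpleGraph.edgeSet_mono hle he'
  rw [SimpleGraph.edgeSet_fromEdgeSet] at this
  exact this.1

theorem le_tmst {γ : ℝ} (h : ∀ F : Finset (Sym2 I.terminals),
    joins (F : Set (Sym2 I.terminals)) = ⊤ → γ ≤ ∑ e ∈ F, I.terminalEdgeCost e) :
    γ ≤ I.tmst := by
  classical
  obtain ⟨r, hr⟩ : I.terminals.Nonempty := Finset.card_pos.1 (by have := I.two_le_card; omega)
  have : Nonempty I.terminals := ⟨⟨r, hr⟩⟩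
  obtain ⟨T₀, -, hT₀⟩ :=
    (SimpleGraph.connected_top (V := I.terminals)).exists_isTree_le
  refine le_csInf ⟨_, T₀, hT₀, rfl⟩ ?_
  rintro q ⟨T, hT, rfl⟩
  refine h _ (top_le_iff.1 fun u v _ => ?_)
  have : joins T.edgeSet u v := by
    rw [joins_rel_iff, SimpleGraph.fromEdgeSet_edgeSet]
    exact hT.connected u v
  refine joins_mono (fun e he => ?_) this
  simpa using he

theorem opt_le_tmst : I.opt ≤ I.tmst := by
  refine I.le_tmst fun F hF => ?_
  simpa using I.opt_le_add_sum (Set.empty_subset _) (X := ∅) (by simp) F (by simp [hF])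

end SteinerInstance

noncomputable section

namespace SteinerInstance

variable (I : SteinerInstance)

/-! ### Root independence of the bidirected cut relaxation -/

open scoped Classical in
/-- The net amount of `g` that leaves the vertex `v`. -/
def netOutflow (g : I.graph.Dart → ℝ) (v : I.V) : ℝ :=
  ∑ d : I.graph.Dart with d.fst = v, g d

open scoped Classical in
theorem sum_eq_zero_of_antisymm (p : I.graph.Dart → Prop) [DecidablePred p]
    (hp : ∀ d, p d → p d.symm) (g : I.graph.Dart → ℝ) (hg : ∀ d, g d.symm = -g d) :
    ∑ d : I.graph.Dart with p d, g d = 0 := by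
  refine Finset.sum_involution (fun d _ => d.symm) ?_ ?_ ?_ ?_
  · intro d _
    rw [hg, add_neg_cancel]
  · intro d _ _
    exact d.symm_ne
  · intro d hd
    simp only [Finset.mem_filter, Finset.mem_univ, true_and] at hd ⊢
    exact hp d hd
  · intro d _
    exact d.symm_symm

open scoped Classical in
theorem sum_leaving_eq_sum_netOutflow (g : I.graph.Dart → ℝ) (hg : ∀ d, g d.symm = -g d)
    (S : Finset I.V) :
    ∑ d : I.graph.Dart with d.fst ∈ S ∧ d.snd ∉ S, g d = ∑ v ∈ S, I.netOutflow g v := by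
  have h1 : ∑ v ∈ S, I.netOutflow g v = ∑ d : I.graph.Dart with d.fst ∈ S, g d := by
    simp only [netOutflow, Finset.sum_filter]
    rw [Finset.sum_comm]
    exact Finset.sum_congr rfl fun d _ => by simp
  have h2 := Finset.sum_filter_add_sum_filter_not
    ({d : I.graph.Dart | d.fst ∈ S} : Finset I.graph.Dart) (fun d => d.snd ∈ S) g
  have h3 : ∑ d : I.graph.Dart with d.fst ∈ S ∧ d.snd ∈ S, g d = 0 :=
    I.sum_eq_zero_of_antisymm (fun d => d.fst ∈ S ∧ d.snd ∈ S) (fun d hd => ⟨hd.2, hd.1⟩) g hg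
  rw [Finset.filter_filter, Finset.filter_filter, h3, zero_add] at h2
  rw [h1, ← h2]

theorem netOutflow_add_mul (g φ : I.graph.Dart → ℝ) (ε : ℝ) (v : I.V) :
    I.netOutflow (fun d => g d + ε * φ d) v = I.netOutflow g v + ε * I.netOutflow φ v := by
  simp only [netOutflow, Finset.sum_add_distrib, Finset.mul_sum]

open scoped Classical in
/-- The unit flow along a single dart. -/
theorem exists_unit_flow_dart (d : I.graph.Dart) : ∃ χ : I.graph.Dart → ℝ,
    (∀ e, χ e.symm = -χ e) ∧ (∀ e, e ≠ d → χ e ≤ 0) ∧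
      ∀ v, I.netOutflow χ v = (if v = d.fst then 1 else 0) - (if v = d.snd then 1 else 0) := by
  refine ⟨fun e => (if e = d then 1 else 0) - (if e = d.symm then 1 else 0), ?_, ?_, ?_⟩
  · intro e
    have h1 : e.symm = d ↔ e = d.symm := by
      constructor
      · rintro rfl; exact (e.symm_symm).symm
      · rintro rfl; exact d.symm_symm
    have h2 : e.symm = d.symm ↔ e = d := SimpleGraph.Dart.symm_involutive.injective.eq_iff
    simp only [h1, h2]
    ring
  · intro e he
    simp only [he, if_false]
    split_ifs <;> norm_num
  · intro v
    simp only [netOutflow, Finset.sum_sub_distrib, Finset.sum_ite_eq', Finset.mem_filter,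
      Finset.mem_univ, true_and, eq_comm (a := v)]
    rfl

open Filter Topology in
open scoped Classical in
/-- Max-flow min-cut for the bidirected cut relaxation: a feasible solution for the root `r`
supports a unit flow from any other terminal `r'` to `r`. Flows are antisymmetric functions on
darts. -/
theorem BCRFeasible.exists_unit_flow {r r' : I.V} (hr' : r' ∈ I.terminals) (hne : r' ≠ r)
    {x : I.graph.Dart → ℝ} (hx : I.BCRFeasible r x) :
    ∃ g : I.graph.Dart → ℝ, (∀ d, g d.symm = -g d) ∧ (∀ d, g d ≤ x d) ∧
      (∀ v, v ≠ r → v ≠ r' → I.netOutflow g v = 0) ∧ I.netOutflow g r' = 1 := by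
  set Z : Set (I.graph.Dart → ℝ) := {g | (∀ d, g d.symm = -g d) ∧ (∀ d, g d ≤ x d) ∧
      (∀ v, v ≠ r → v ≠ r' → I.netOutflow g v = 0) ∧ I.netOutflow g r' ≤ 1} with hZ
  have hcont : ∀ v, Continuous fun g : I.graph.Dart → ℝ => I.netOutflow g v := fun v =>
    continuous_finsetSum _ fun d _ => continuous_apply d
  have hZc : IsCompact Z := by
    refine (isCompact_Icc (a := fun d => -x d.symm) (b := x)).of_isClosed_subset ?_ ?_
    · simp only [hZ, Set.ofPred_and, Set.ofPred_forall]
      refine (isClosed_iInter fun d => ?_).inter ((isClosed_iInter fun d => ?_).inter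
        ((isClosed_iInter fun v => isClosed_iInter fun _ => isClosed_iInter fun _ => ?_).inter ?_))
      · exact isClosed_eq (continuous_apply _) (continuous_apply d).neg
      · exact isClosed_le (continuous_apply d) continuous_const
      · exact isClosed_eq (hcont v) continuous_const
      · exact isClosed_le (hcont r') continuous_const
    · rintro g ⟨h1, h2, -, -⟩
      refine ⟨fun d => ?_, fun d => h2 d⟩
      have := h2 d.symm
      rw [h1] at this
      linarith
  have hZne : Z.Nonempty := ⟨0, by simp [hZ, netOutflow, hx.1]⟩
  obtain ⟨g, ⟨hanti, hle, hcons, hone⟩, hmax⟩ := hZc.exists_isMaxOn hZne (hcont r').continuousOn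
  refine ⟨g, hanti, hle, hcons, ?_⟩
  by_contra hlt
  have hlt : I.netOutflow g r' < 1 := lt_of_le_of_ne hone hlt
  -- `A` is the set of vertices reachable from `r'` in the residual network.
  set A : Finset I.V := {v | ∃ φ : I.graph.Dart → ℝ, (∀ d, φ d.symm = -φ d) ∧
    (∀ d, g d = x d → φ d ≤ 0) ∧
    ∀ w, I.netOutflow φ w = (if w = r' then 1 else 0) - (if w = v then 1 else 0)} with hA
  have hmemA : ∀ v, v ∈ A ↔ ∃ φ : I.graph.Dart → ℝ, (∀ d, φ d.symm = -φ d) ∧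
    (∀ d, g d = x d → φ d ≤ 0) ∧
    ∀ w, I.netOutflow φ w = (if w = r' then 1 else 0) - (if w = v then 1 else 0) := by
    simp [hA]
  have hr'A : r' ∈ A := (hmemA r').2 ⟨0, by simp [netOutflow]⟩
  have hclosed : ∀ d : I.graph.Dart, d.fst ∈ A → d.snd ∉ A → g d = x d := by
    intro d hd hd'
    by_contra hne'
    obtain ⟨φ, h1, h2, h3⟩ := (hmemA _).1 hd
    obtain ⟨χ, k1, k2, k3⟩ := I.exists_unit_flow_dart d
    refine hd' ((hmemA _).2 ⟨fun e => φ e + 1 * χ e, fun e => ?_, fun e he => ?_, fun w => ?_⟩)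
    · simp only [h1, k1]; ring
    · have := k2 e (by rintro rfl; exact hne' he)
      have := h2 e he
      linarith
    · rw [netOutflow_add_mul, h3, k3]; ring
  by_cases hrA : r ∈ A
  · obtain ⟨φ, h1, h2, h3⟩ := (hmemA _).1 hrA
    have hφr' : I.netOutflow φ r' = 1 := by rw [h3]; simp [hne]
    have hev : ∀ᶠ ε in 𝓝[>] (0 : ℝ), (∀ d, g d + ε * φ d ≤ x d) ∧ I.netOutflow g r' + ε ≤ 1 := by
      refine (eventually_all.2 fun d => ?_).and ?_
      · rcases (hle d).eq_or_lt with heq | hlt'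
        · filter_upwards [self_mem_nhdsWithin] with ε hε
          have := mul_nonpos_of_nonneg_of_nonpos (le_of_lt (Set.mem_Ioi.1 hε)) (h2 d heq)
          linarith
        · have : Tendsto (fun ε : ℝ => g d + ε * φ d) (𝓝[>] 0) (𝓝 (g d + 0 * φ d)) :=
            ((by fun_prop : Continuous fun ε : ℝ => g d + ε * φ d).tendsto 0).mono_left
              nhdsWithin_le_nhds
          rw [zero_mul, add_zero] at this
          filter_upwards [this.eventually (gt_mem_nhds hlt')] with ε hε using hε.le
      · have : Tendsto (fun ε : ℝ => I.netOutflow g r' + ε) (𝓝[>] 0)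
            (𝓝 (I.netOutflow g r' + 0)) :=
          ((by fun_prop : Continuous fun ε : ℝ => I.netOutflow g r' + ε).tendsto 0).mono_left
            nhdsWithin_le_nhds
        rw [add_zero] at this
        filter_upwards [this.eventually (gt_mem_nhds hlt)] with ε hε using hε.le
    obtain ⟨ε, ⟨he1, he2⟩, hε⟩ := (hev.and self_mem_nhdsWithin).exists
    have hε : 0 < ε := hε
    have hnew : (fun d => g d + ε * φ d) ∈ Z := by
      refine ⟨fun d => ?_, he1, fun v hv hv' => ?_, ?_⟩
      · simp only [hanti, h1]; ring
      · rw [netOutflow_add_mul, hcons v hv hv', h3]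
        simp [hv, hv']
      · rw [netOutflow_add_mul, hφr']
        linarith
    have := hmax hnew
    simp only [Set.mem_ofPred_eq, netOutflow_add_mul, hφr'] at this
    linarith
  · have hcut := hx.2 A hrA ⟨r', Finset.mem_inter.2 ⟨hr'A, hr'⟩⟩
    have heq : ∑ d : I.graph.Dart with d.fst ∈ A ∧ d.snd ∉ A, x d =
        ∑ d : I.graph.Dart with d.fst ∈ A ∧ d.snd ∉ A, g d := by
      refine Finset.sum_congr rfl fun d hd => ?_
      obtain ⟨h1, h2⟩ := (Finset.mem_filter.1 hd).2
      exact (hclosed d h1 h2).symm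
    rw [heq, I.sum_leaving_eq_sum_netOutflow g hanti,
      Finset.sum_eq_single_of_mem r' hr'A fun v hv hv' =>
        hcons v (by rintro rfl; exact hrA hv) hv'] at hcut
    linarith

open scoped Classical in
/-- Sending a unit of flow from `r'` to `r` backwards turns a feasible solution for the root `r`
into one for the root `r'`. The cost does not change, as both orientations of an edge cost the
same. -/
theorem BCRFeasible.exists_change_root {r r' : I.V} (hr' : r' ∈ I.terminals)
    {x : I.graph.Dart → ℝ} (hx : I.BCRFeasible r x) :
    ∃ x' : I.graph.Dart → ℝ, I.BCRFeasible r' x' ∧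
      ∑ d : I.graph.Dart, I.cost d.edge * x' d = ∑ d : I.graph.Dart, I.cost d.edge * x d := by
  by_cases hne : r' = r
  · exact ⟨x, hne ▸ hx, rfl⟩
  obtain ⟨g, hanti, hle, hcons, hone⟩ := BCRFeasible.exists_unit_flow I hr' hne hx
  have htotal : I.netOutflow g r = -1 := by
    have h0 := I.sum_leaving_eq_sum_netOutflow g hanti Finset.univ
    rw [← Finset.add_sum_erase _ _ (Finset.mem_univ r),
      Finset.sum_eq_single_of_mem r' (by simp [hne]) fun v hv hv' =>
        hcons v (Finset.ne_of_mem_erase hv) hv', hone] at h0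
    simp at h0
    linarith
  refine ⟨fun d => x d - g d, ⟨fun d => sub_nonneg.2 (hle d), fun S hS hSR => ?_⟩, ?_⟩
  · rw [Finset.sum_sub_distrib, I.sum_leaving_eq_sum_netOutflow g hanti]
    by_cases hrS : r ∈ S
    · rw [Finset.sum_eq_single_of_mem r hrS fun v hv hv' =>
        hcons v hv' (by rintro rfl; exact hS hv), htotal]
      have := Finset.sum_nonneg
        (s := ({d : I.graph.Dart | d.fst ∈ S ∧ d.snd ∉ S} : Finset I.graph.Dart))
        fun d _ => hx.1 d
      linarith
    · rw [Finset.sum_eq_zero fun v hv =>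
        hcons v (by rintro rfl; exact hrS hv) (by rintro rfl; exact hS hv), sub_zero]
      exact hx.2 S hrS hSR
  · have h0 := I.sum_eq_zero_of_antisymm (fun _ => True) (fun _ _ => trivial)
      (fun d => I.cost d.edge * g d) fun d => by rw [hanti, SimpleGraph.Dart.edge_symm]; ring
    rw [Finset.filter_true] at h0
    simp only [mul_sub, Finset.sum_sub_distrib, h0, sub_zero]

theorem cost_dart_pos (d : I.graph.Dart) : 0 < I.cost d.edge := I.cost_pos _ d.edge_mem

open scoped Classical in
theorem bcr_le {r : I.V} {x : I.graph.Dart → ℝ} (hx : I.BCRFeasible r x) :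
    I.bcr r ≤ ∑ d : I.graph.Dart, I.cost d.edge * x d := by
  refine csInf_le ⟨0, ?_⟩ ⟨x, hx, rfl⟩
  rintro q ⟨x, hx, rfl⟩
  exact Finset.sum_nonneg fun d _ => mul_nonneg (I.cost_dart_pos d).le (hx.1 d)

theorem bcrFeasible_one {r : I.V} (hr : r ∈ I.terminals) : I.BCRFeasible r fun _ => 1 := by
  classical
  refine ⟨fun _ => zero_le_one, fun S hS hSR => ?_⟩
  obtain ⟨t, ht⟩ := hSR
  rw [Finset.mem_inter] at ht
  obtain ⟨p⟩ := I.terminals_reachable t ht.2 r hr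
  obtain ⟨d, -, hd, hd'⟩ := p.exists_boundary_dart (S : Set I.V) ht.1 hS
  exact Finset.single_le_sum (f := fun _ : I.graph.Dart => (1 : ℝ)) (fun _ _ => zero_le_one)
    (Finset.mem_filter.2 ⟨Finset.mem_univ d, hd, hd'⟩)

open scoped Classical in
theorem le_bcr {r : I.V} (hr : r ∈ I.terminals) {γ : ℝ}
    (h : ∀ x, I.BCRFeasible r x → γ ≤ ∑ d : I.graph.Dart, I.cost d.edge * x d) :
    γ ≤ I.bcr r := by
  refine le_csInf ⟨_, _, I.bcrFeasible_one hr, rfl⟩ ?_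
  rintro q ⟨x, hx, rfl⟩
  exact h x hx

theorem bcr_pos {r : I.V} (hr : r ∈ I.terminals) : 0 < I.bcr r := by
  classical
  obtain ⟨m, hm, hmc⟩ := I.exists_pos_le_cost
  obtain ⟨t, ht, htr⟩ := I.exists_mem_terminals_ne r
  refine hm.trans_le (I.le_bcr hr fun x hx => ?_)
  have hcut := hx.2 {t} (by simpa using htr.symm) ⟨t, by simp [ht]⟩
  calc m ≤ m * ∑ d : I.graph.Dart with d.fst ∈ ({t} : Finset I.V) ∧ d.snd ∉ ({t} : Finset I.V),
          x d := le_mul_of_one_le_right hm.le hcut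
    _ ≤ m * ∑ d : I.graph.Dart, x d := by
        gcongr
        · exact fun d _ _ => hx.1 d
        · exact Finset.filter_subset _ _
    _ ≤ ∑ d : I.graph.Dart, I.cost d.edge * x d := by
        rw [Finset.mul_sum]
        gcongr with d
        · exact hx.1 d
        · exact hmc _ d.edge_mem

theorem bcr_le_bcr_of_root {r r' : I.V} (hr : r ∈ I.terminals) (hr' : r' ∈ I.terminals) :
    I.bcr r' ≤ I.bcr r := by
  refine I.le_bcr hr fun x hx => ?_
  obtain ⟨x', hx', hcost⟩ := BCRFeasible.exists_change_root I hr' hx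
  exact hcost ▸ I.bcr_le hx'

end SteinerInstance

/-! ### Completing a partition at minimum cost -/

section Completion

variable {α : Type*} [Finite α]

/-- The number of classes of a partition. -/
def numClasses (s : Setoid α) : ℕ := Nat.card (Quotient s)

theorem numClasses_sup_pair {s : Setoid α} {a b : α} (hab : ¬ s a b) :
    numClasses (s ⊔ clump {a, b}) + 1 = numClasses s := by
  classical
  have hle : s ≤ s ⊔ clump {a, b} := le_sup_left
  -- Erasing the class of `b` leaves the classes of the coarser partition.
  let f : {q : Quotient s // q ≠ Quotient.mk s b} → Quotient (s ⊔ clump {a, b}) :=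
    fun q => Quotient.map' (s₁ := s) (s₂ := s ⊔ clump {a, b}) id (fun _ _ h => hle h) q.1
  have hf : Function.Bijective f := by
    constructor
    · rintro ⟨p, hp⟩ ⟨q, hq⟩ hpq
      induction p using Quotient.inductionOn with | _ u
      induction q using Quotient.inductionOn with | _ v
      have huv : (s ⊔ clump {a, b}) u v := Quotient.exact hpq
      have hu : ¬ s u b := fun h => hp (Quotient.sound h)
      have hv : ¬ s v b := fun h => hq (Quotient.sound h)
      rcases sup_clump_pair_rel_iff.1 huv with h | ⟨-, h⟩ | ⟨h, -⟩
      · exact Subtype.ext (Quotient.sound h)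
      · exact absurd (s.symm' h) hv
      · exact absurd h hu
    · intro q
      induction q using Quotient.inductionOn with | _ v
      by_cases hv : s v b
      · refine ⟨⟨Quotient.mk s a, fun h => hab (Quotient.exact h)⟩, Quotient.sound ?_⟩
        exact sup_clump_pair_rel_iff.2 (Or.inr (Or.inl ⟨s.refl' a, s.symm' hv⟩))
      · exact ⟨⟨Quotient.mk s v, fun h => hv (Quotient.exact h)⟩, rfl⟩
  have := Fintype.ofFinite (Quotient s)
  have h1 := Nat.card_congr (Equiv.ofBijective f hf)
  have h2 : 0 < Fintype.card (Quotient s) := Fintype.card_pos_iff.2 ⟨Quotient.mk s a⟩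
  rw [Nat.card_eq_fintype_card, Fintype.card_subtype_compl, Fintype.card_subtype_eq] at h1
  rw [numClasses, numClasses, Nat.card_eq_fintype_card (α := Quotient s)]
  omega

/-- Merging all classes that meet `X` decreases the number of classes by the number of these
classes minus one. -/
theorem numClasses_sup_clump_add_le (s : Setoid α) (X : Set α) :
    numClasses (s ⊔ clump X) + (Quotient.mk s '' X).ncard ≤ numClasses s + 1 := by
  classical
  rcases X.eq_empty_or_nonempty with rfl | ⟨x, hx⟩
  · have : s ⊔ clump (∅ : Set α) = s := sup_eq_left.2 (clump_le_iff.2 (by simp))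
    simp [this]
  have hle : s ≤ s ⊔ clump X := le_sup_left
  let C : Set (Quotient s) := (Quotient.mk s '' X)ᶜ
  let f : Option C → Quotient (s ⊔ clump X) := fun o => o.elim (Quotient.mk _ x)
    fun q => Quotient.map' (s₁ := s) (s₂ := s ⊔ clump X) id (fun _ _ h => hle h) q.1
  have hf : Function.Surjective f := by
    intro q
    induction q using Quotient.inductionOn with | _ v
    by_cases hv : Quotient.mk s v ∈ Quotient.mk s '' X
    · obtain ⟨u, hu, huv⟩ := hv
      refine ⟨none, Quotient.sound ?_⟩
      exact Setoid.trans' _ (clump_le_iff.1 le_sup_right x hx u hu) (hle (Quotient.exact huv))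
    · exact ⟨some ⟨Quotient.mk s v, hv⟩, rfl⟩
  have h1 := Nat.card_le_card_of_surjective f hf
  rw [Finite.card_option, Nat.card_coe_set_eq] at h1
  have h2 := Set.ncard_add_ncard_compl (Quotient.mk s '' X)
  simp only [numClasses]
  change _ ≤ C.ncard + 1 at h1
  change _ + C.ncard = _ at h2
  omega

variable (w : Sym2 α → ℝ)

/-- The minimum weight of an edge set that connects the classes of the partition `s`. -/
def completionCost (s : Setoid α) : ℝ :=
  sInf {q : ℝ | ∃ F : Finset (Sym2 α), s ⊔ joins (F : Set (Sym2 α)) = ⊤ ∧ q = ∑ e ∈ F, w e}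

theorem finite_completion_weights (s : Setoid α) :
    {q : ℝ | ∃ F : Finset (Sym2 α), s ⊔ joins (F : Set (Sym2 α)) = ⊤ ∧
      q = ∑ e ∈ F, w e}.Finite := by
  have := Fintype.ofFinite (Sym2 α)
  refine (Set.finite_range fun F : Finset (Sym2 α) => ∑ e ∈ F, w e).subset ?_
  rintro q ⟨F, -, rfl⟩
  exact ⟨F, rfl⟩

theorem completionCost_le {s : Setoid α} {F : Finset (Sym2 α)}
    (hF : s ⊔ joins (F : Set (Sym2 α)) = ⊤) : completionCost w s ≤ ∑ e ∈ F, w e :=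
  csInf_le (finite_completion_weights w s).bddBelow ⟨F, hF, rfl⟩

theorem exists_completion (s : Setoid α) : ∃ F : Finset (Sym2 α),
    s ⊔ joins (F : Set (Sym2 α)) = ⊤ ∧ completionCost w s = ∑ e ∈ F, w e := by
  have := Fintype.ofFinite (Sym2 α)
  have hne : {q : ℝ | ∃ F : Finset (Sym2 α), s ⊔ joins (F : Set (Sym2 α)) = ⊤ ∧
      q = ∑ e ∈ F, w e}.Nonempty :=
    ⟨_, Finset.univ, top_le_iff.1 fun u v _ =>
      (le_sup_right : joins _ ≤ s ⊔ joins _) (joins_rel_of_mem (by simp)), rfl⟩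
  exact hne.csInf_mem (finite_completion_weights w s)

theorem completionCost_le_add {s : Setoid α} {a b : α} (hw : 0 ≤ w s(a, b)) :
    completionCost w s ≤ w s(a, b) + completionCost w (s ⊔ clump {a, b}) := by
  classical
  obtain ⟨F, hF, hcost⟩ := exists_completion w (s ⊔ clump {a, b})
  have hins : s ⊔ joins ((insert s(a, b) F : Finset (Sym2 α)) : Set (Sym2 α)) = ⊤ := by
    rw [Finset.coe_insert, joins_insert, ← hF]
    rw [sup_assoc, sup_comm (clump _)]
  refine (completionCost_le w hins).trans ?_
  rw [hcost]
  by_cases h : s(a, b) ∈ F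
  · rw [Finset.insert_eq_of_mem h]
    linarith
  · rw [Finset.sum_insert h]

/-- The greedy step: a lightest edge between distinct classes belongs to a cheapest completion. -/
theorem add_completionCost_le {s : Setoid α} {a b : α} (hab : ¬ s a b)
    (hmin : ∀ u v, ¬ s u v → w s(a, b) ≤ w s(u, v)) :
    w s(a, b) + completionCost w (s ⊔ clump {a, b}) ≤ completionCost w s := by
  classical
  obtain ⟨F, hF, hcost⟩ := exists_completion w s
  -- `F'` is a maximal part of `F` that does not connect `a` and `b`; any further edge of `F`
  -- can be exchanged for the edge between `a` and `b`.
  obtain ⟨F', hF'mem, hF'max⟩ := Finset.exists_max_image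
    (F.powerset.filter fun F' : Finset (Sym2 α) => ¬ (s ⊔ joins (F' : Set (Sym2 α))) a b) Finset.card
    ⟨∅, Finset.mem_filter.2 ⟨Finset.empty_mem_powerset _, by
      have : joins ((∅ : Finset (Sym2 α)) : Set (Sym2 α)) ≤ s := joins_le_iff.2 (by simp)
      rw [sup_eq_left.2 this]
      exact hab⟩⟩
  rw [Finset.mem_filter, Finset.mem_powerset] at hF'mem
  obtain ⟨hF'F, hF'ab⟩ := hF'mem
  have hne : F' ≠ F := by
    rintro rfl
    rw [hF] at hF'ab
    exact hF'ab trivial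
  obtain ⟨f, hfF, hfF'⟩ := Finset.exists_of_ssubset (hF'F.ssubset_of_ne hne)
  have hins : (s ⊔ joins ((insert f F' : Finset (Sym2 α)) : Set (Sym2 α))) a b := by
    by_contra hcon
    have := hF'max (insert f F') (Finset.mem_filter.2
      ⟨Finset.mem_powerset.2 (Finset.insert_subset hfF hF'F), hcon⟩)
    rw [Finset.card_insert_of_notMem hfF'] at this
    omega
  induction f with
  | _ p q =>
    rw [Finset.coe_insert, joins_insert, ← sup_assoc] at hins
    set t := s ⊔ joins (F' : Set (Sym2 α)) with ht
    have hst : s ≤ t := le_sup_left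
    have hpq : ¬ s p q := by
      intro h
      rw [sup_eq_left.2 (clump_pair_le_iff.2 (hst h))] at hins
      exact hF'ab hins
    have hF'erase : F' ⊆ F.erase s(p, q) := fun e he =>
      Finset.mem_erase.2 ⟨by rintro rfl; exact hfF' he, hF'F he⟩
    have htle : t ⊔ clump {a, b} ≤
        s ⊔ clump {a, b} ⊔ joins ((F.erase s(p, q) : Finset (Sym2 α)) : Set (Sym2 α)) := by
      refine sup_le (sup_le (le_sup_of_le_left le_sup_left)
        (le_sup_of_le_right (joins_mono ?_))) (le_sup_of_le_left le_sup_right)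
      exact_mod_cast hF'erase
    have hpq' : (t ⊔ clump {a, b}) p q := by
      rcases sup_clump_pair_rel_iff.1 hins with h | ⟨h, h'⟩ | ⟨h, h'⟩
      · exact absurd h hF'ab
      · exact sup_clump_pair_rel_iff.2 (Or.inr (Or.inl ⟨t.symm' h, t.symm' h'⟩))
      · exact sup_clump_pair_rel_iff.2 (Or.inr (Or.inr ⟨h', h⟩))
    have hcomp : s ⊔ clump {a, b} ⊔
        joins ((F.erase s(p, q) : Finset (Sym2 α)) : Set (Sym2 α)) = ⊤ := by
      rw [← top_le_iff, ← hF]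
      refine sup_le (le_sup_of_le_left le_sup_left) (joins_le_iff.2 fun u v huv => ?_)
      by_cases h : s(u, v) = s(p, q)
      · rcases Sym2.eq_iff.1 h with ⟨rfl, rfl⟩ | ⟨rfl, rfl⟩
        exacts [htle hpq', Setoid.symm' _ (htle hpq')]
      · exact (le_sup_right : joins _ ≤ _ ⊔ joins _)
          (joins_rel_of_mem (Finset.mem_coe.2 (Finset.mem_erase.2 ⟨h, huv⟩)))
    have h1 := completionCost_le w hcomp
    have h2 := Finset.add_sum_erase F w hfF
    have h3 := hmin p q hpq
    linarith

theorem completionCost_top : completionCost w ⊤ ≤ 0 := by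
  simpa using completionCost_le w (s := ⊤) (F := ∅) (by simp)

/-- The potential of a partition whose classes are at distance at least `l`: the completion cost
in excess of `l` per edge. -/
def excess (l : ℝ) (s : Setoid α) : ℝ := completionCost w s - l * (numClasses s - 1)

theorem excess_le_excess_sup_pair (hw : ∀ e, 0 ≤ w e) (s : Setoid α) (a b : α) :
    excess w (w s(a, b)) s ≤ excess w (w s(a, b)) (s ⊔ clump {a, b}) := by
  by_cases h : s a b
  · rw [sup_eq_left.2 (clump_pair_le_iff.2 h)]
  · have h1 := completionCost_le_add w (s := s) (hw s(a, b))
    have h2 : (numClasses (s ⊔ clump {a, b}) : ℝ) + 1 = numClasses s := by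
      exact_mod_cast numClasses_sup_pair h
    simp only [excess, ← h2]
    nlinarith

theorem excess_eq_excess_sup_pair (hw : ∀ e, 0 ≤ w e) {s : Setoid α} {a b : α} (hab : ¬ s a b)
    (hmin : ∀ u v, ¬ s u v → w s(a, b) ≤ w s(u, v)) :
    excess w (w s(a, b)) s = excess w (w s(a, b)) (s ⊔ clump {a, b}) := by
  refine (excess_le_excess_sup_pair w hw s a b).antisymm ?_
  have h1 := add_completionCost_le w hab hmin
  have h2 : (numClasses (s ⊔ clump {a, b}) : ℝ) + 1 = numClasses s := by
    exact_mod_cast numClasses_sup_pair hab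
  simp only [excess, ← h2]
  nlinarith

/-- The bridge lemma, relative to a partition `s` whose classes are at distance at least `l`: if
the sets `X i` with multiplicities `x i` fractionally merge all partitions, then the savings that
they provide pay for completing `s`. Raising `l` to the distance of the closest two classes is
paid for by the merging property, and merging these two classes does not change the potential. -/
theorem excess_le_sum_excess_sub [Nonempty α] (hw : ∀ e, 0 ≤ w e) {ι : Type*} (J : Finset ι)
    (x : ι → ℝ) (hx : ∀ i ∈ J, 0 ≤ x i) (X : ι → Set α)
    (hmerge : ∀ s : Setoid α,
      (numClasses s : ℝ) - 1 ≤ ∑ i ∈ J, x i * (numClasses s - numClasses (s ⊔ clump (X i)))) :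
    ∀ (n : ℕ) (s : Setoid α) (l : ℝ), numClasses s = n → (∀ u v, ¬ s u v → l ≤ w s(u, v)) →
      excess w l s ≤ ∑ i ∈ J, x i * (excess w l s - excess w l (s ⊔ clump (X i))) := by
  intro n
  induction n with
  | zero =>
    intro s l hs
    have : Nonempty (Quotient s) := Nonempty.map (Quotient.mk s) inferInstance
    have : 0 < numClasses s := Nat.card_pos
    omega
  | succ n ih =>
    intro s l hs hl
    by_cases htop : s = ⊤
    · subst htop
      have h1 : numClasses (⊤ : Setoid α) = 1 := by
        have : Subsingleton (Quotient (⊤ : Setoid α)) :=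
          ⟨fun p q => Quotient.inductionOn₂ p q fun _ _ => Quotient.sound trivial⟩
        exact Nat.card_eq_one_iff_unique.2 ⟨this, Nonempty.map (Quotient.mk ⊤) inferInstance⟩
      simp [excess, h1, completionCost_top w]
    obtain ⟨u₀, v₀, huv₀⟩ : ∃ u v, ¬ s u v := by
      by_contra! hcon
      exact htop (top_le_iff.1 fun u v _ => hcon u v)
    obtain ⟨⟨a, b⟩, hab, hmin⟩ := Set.exists_min_image {p : α × α | ¬ s p.1 p.2}
      (fun p => w s(p.1, p.2)) (Set.toFinite _) ⟨(u₀, v₀), huv₀⟩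
    have hab : ¬ s a b := hab
    have hmin : ∀ u v, ¬ s u v → w s(a, b) ≤ w s(u, v) := fun u v h => hmin (u, v) h
    have hcard := numClasses_sup_pair hab
    have hle : s ≤ s ⊔ clump {a, b} := le_sup_left
    have key := ih (s ⊔ clump {a, b}) (w s(a, b)) (by omega)
      fun u v h => hmin u v fun h' => h (hle h')
    rw [← excess_eq_excess_sup_pair w hw hab hmin] at key
    have step : ∑ i ∈ J, x i * (excess w (w s(a, b)) s -
          excess w (w s(a, b)) (s ⊔ clump {a, b} ⊔ clump (X i))) ≤
        ∑ i ∈ J, x i * (excess w (w s(a, b)) s -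
          excess w (w s(a, b)) (s ⊔ clump (X i))) := by
      refine Finset.sum_le_sum fun i hi => mul_le_mul_of_nonneg_left ?_ (hx i hi)
      have := excess_le_excess_sup_pair w hw (s ⊔ clump (X i)) a b
      rw [sup_right_comm] at this
      linarith
    have raise : ∀ t : Setoid α,
        excess w l t = excess w (w s(a, b)) t + (w s(a, b) - l) * (numClasses t - 1) := by
      intro t
      simp only [excess]
      ring
    have hsum : ∑ i ∈ J, x i * (excess w l s - excess w l (s ⊔ clump (X i))) =
        ∑ i ∈ J, x i * (excess w (w s(a, b)) s - excess w (w s(a, b)) (s ⊔ clump (X i))) +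
        (w s(a, b) - l) *
          ∑ i ∈ J, x i * (numClasses s - numClasses (s ⊔ clump (X i)) : ℝ) := by
      rw [Finset.mul_sum, ← Finset.sum_add_distrib]
      refine Finset.sum_congr rfl fun i _ => ?_
      rw [raise s, raise (s ⊔ clump (X i))]
      ring
    rw [hsum, raise s]
    have := mul_le_mul_of_nonneg_left (hmerge s) (sub_nonneg.2 (hl a b hab))
    linarith

end Completion

namespace SteinerInstance

variable (I : SteinerInstance)

/-! ### The hypergraphic relaxation of MST-optimal instances -/

open scoped Classical in
theorem hypFeasible_single {r : I.V} (hr : r ∈ I.terminals) :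
    I.HypFeasible r fun p => if p = (I.terminals, r) then 1 else 0 := by
  refine ⟨fun p _ => by dsimp only; split_ifs <;> norm_num, fun S hS hSR hrS => ?_⟩
  have hmem : (I.terminals, r) ∈ I.leaving S := by
    obtain ⟨t, ht⟩ := hS
    simp only [leaving, directedComponents, Finset.mem_filter, Finset.mem_product,
      Finset.mem_powerset]
    exact ⟨⟨⟨subset_rfl, hr⟩, hr⟩, ⟨t, Finset.mem_inter.2 ⟨hSR ht, ht⟩⟩, hrS⟩
  simp [hmem]

theorem mem_directedComponents {p : Finset I.V × I.V} :
    p ∈ I.directedComponents ↔ p.1 ⊆ I.terminals ∧ p.2 ∈ p.1 := by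
  simp only [directedComponents, Finset.mem_filter, Finset.mem_product, Finset.mem_powerset]
  exact ⟨fun h => ⟨h.1.1, h.2⟩, fun h => ⟨⟨h.1, h.1 h.2⟩, h.2⟩⟩

open scoped Classical in
theorem mem_leaving {S : Finset I.V} {p : Finset I.V × I.V} :
    p ∈ I.leaving S ↔ p ∈ I.directedComponents ∧ (p.1 ∩ S).Nonempty ∧ p.2 ∉ S := by
  simp only [leaving, Finset.mem_filter]

theorem le_hyp {r : I.V} (hr : r ∈ I.terminals) {γ : ℝ}
    (h : ∀ x, I.HypFeasible r x → γ ≤ ∑ p ∈ I.directedComponents, I.connectCost p.1 * x p) :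
    γ ≤ I.hyp r := by
  refine le_csInf ⟨_, _, I.hypFeasible_single hr, rfl⟩ ?_
  rintro q ⟨x, hx, rfl⟩
  exact h x hx

theorem hyp_le {r : I.V} {x : Finset I.V × I.V → ℝ} (hx : I.HypFeasible r x) :
    I.hyp r ≤ ∑ p ∈ I.directedComponents, I.connectCost p.1 * x p := by
  refine csInf_le ⟨0, ?_⟩ ⟨x, hx, rfl⟩
  rintro q ⟨x, hx, rfl⟩
  exact Finset.sum_nonneg fun p hp =>
    mul_nonneg (I.connectCost_nonneg (I.mem_directedComponents.1 hp).1) (hx.1 p hp)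

/-- The partition inequalities: summing the constraints for all classes that do not contain the
root, a component `(X, v)` is counted at most once for each class met by `X`, other than that
of `v`. -/
theorem HypFeasible.numClasses_sub_one_le {r : I.V} (hr : r ∈ I.terminals)
    {x : Finset I.V × I.V → ℝ} (hx : I.HypFeasible r x) (s : Setoid I.terminals) :
    (numClasses s : ℝ) - 1 ≤ ∑ p ∈ I.directedComponents,
      x p * (numClasses s - numClasses (s ⊔ clump {u : I.terminals | (u : I.V) ∈ p.1})) := by
  classical
  let cls : Quotient s → Finset I.V := fun q =>
    ({u : I.terminals | Quotient.mk s u = q} : Finset I.terminals).map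
      (Function.Embedding.subtype _)
  have hcls : ∀ q (u : I.terminals), (u : I.V) ∈ cls q ↔ Quotient.mk s u = q := by
    intro q u
    simp [cls]
  have := Fintype.ofFinite (Quotient s)
  set Q : Finset (Quotient s) := Finset.univ.erase (Quotient.mk s ⟨r, hr⟩) with hQ
  have hQcard : (numClasses s : ℝ) - 1 = Q.card := by
    have h1 : Q.card + 1 = Fintype.card (Quotient s) :=
      Finset.card_erase_add_one (Finset.mem_univ _)
    rw [numClasses, Nat.card_eq_fintype_card, ← h1]
    push_cast
    ring
  calc (numClasses s : ℝ) - 1 = ∑ q ∈ Q, 1 := by rw [hQcard]; simp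
    _ ≤ ∑ q ∈ Q, ∑ p ∈ I.leaving (cls q), x p := by
        refine Finset.sum_le_sum fun q hq => hx.2 _ ?_ ?_ ?_
        · induction q using Quotient.inductionOn with | _ u
          exact ⟨u, (hcls _ _).2 rfl⟩
        · intro v hv
          obtain ⟨u, -, rfl⟩ := Finset.mem_map.1 hv
          exact u.2
        · intro h
          exact Finset.ne_of_mem_erase hq ((hcls q ⟨r, hr⟩).1 h).symm
    _ = ∑ p ∈ I.directedComponents, ∑ q ∈ Q,
          if (p.1 ∩ cls q).Nonempty ∧ p.2 ∉ cls q then x p else 0 := by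
        rw [Finset.sum_comm]
        refine Finset.sum_congr rfl fun q _ => ?_
        simp only [leaving, Finset.sum_filter]
    _ ≤ _ := by
        refine Finset.sum_le_sum fun p hp => ?_
        obtain ⟨hpR, hpv⟩ := I.mem_directedComponents.1 hp
        rw [← Finset.sum_filter, Finset.sum_const, nsmul_eq_mul, mul_comm]
        refine mul_le_mul_of_nonneg_left ?_ (hx.1 p hp)
        set X : Set I.terminals := {u : I.terminals | (u : I.V) ∈ p.1} with hX
        have hmerge := numClasses_sup_clump_add_le s X
        have hsub : ((insert (Quotient.mk s ⟨p.2, hpR hpv⟩)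
            {q ∈ Q | (p.1 ∩ cls q).Nonempty ∧ p.2 ∉ cls q} : Finset (Quotient s)) :
              Set (Quotient s)) ⊆ Quotient.mk s '' X := by
          intro q hq
          rcases Finset.mem_insert.1 (Finset.mem_coe.1 hq) with rfl | hq
          · exact ⟨_, hpv, rfl⟩
          · obtain ⟨u, hu⟩ := (Finset.mem_filter.1 hq).2.1
            rw [Finset.mem_inter] at hu
            exact ⟨⟨u, hpR hu.1⟩, hu.1, (hcls q ⟨u, hpR hu.1⟩).1 hu.2⟩
        have hcard := Set.ncard_le_ncard hsub (Set.toFinite _)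
        rw [Set.ncard_coe_finset, Finset.card_insert_of_notMem (fun h =>
          (Finset.mem_filter.1 h).2.2 ((hcls _ ⟨p.2, hpR hpv⟩).2 rfl))] at hcard
        have h2 : numClasses (s ⊔ clump X) +
            ({q ∈ Q | (p.1 ∩ cls q).Nonempty ∧ p.2 ∉ cls q} : Finset (Quotient s)).card ≤
              numClasses s := by omega
        have h3 : (numClasses (s ⊔ clump X) : ℝ) +
            ({q ∈ Q | (p.1 ∩ cls q).Nonempty ∧ p.2 ∉ cls q} : Finset (Quotient s)).card ≤
              numClasses s := by exact_mod_cast h2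
        linarith

/-- In an MST-optimal instance no component costs less than it saves in a terminal minimum
spanning tree, so the bridge lemma bounds the hypergraphic relaxation from below. -/
theorem MSTOptimal.opt_le_hyp (hI : I.MSTOptimal) {r : I.V} (hr : r ∈ I.terminals) :
    I.opt ≤ I.hyp r := by
  refine I.le_hyp hr fun x hx => ?_
  set w := I.terminalEdgeCost with hw
  have hw0 : ∀ e, 0 ≤ w e := I.terminalEdgeCost_nonneg
  have : Nonempty I.terminals := ⟨⟨r, hr⟩⟩
  have htmst : I.tmst = completionCost w ⊥ := by
    apply le_antisymm
    · obtain ⟨F, hF, hcost⟩ := exists_completion w (⊥ : Setoid I.terminals)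
      rw [bot_sup_eq] at hF
      exact hcost ▸ I.tmst_le_sum F hF
    · exact I.le_tmst fun F hF => completionCost_le w (by rw [bot_sup_eq, hF])
  have hbridge := excess_le_sum_excess_sub w hw0 I.directedComponents x hx.1
    (fun p => {u : I.terminals | (u : I.V) ∈ p.1})
    (HypFeasible.numClasses_sub_one_le I hr hx) _ ⊥ 0 rfl fun _ _ _ => hw0 _
  simp only [excess, zero_mul, sub_zero, bot_sup_eq] at hbridge
  rw [← hI, htmst]
  refine hbridge.trans (Finset.sum_le_sum fun p hp => ?_)
  rw [mul_comm]
  refine mul_le_mul_of_nonneg_right ?_ (hx.1 p hp)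
  refine I.le_connectCost (I.mem_directedComponents.1 hp).1 fun K hK => ?_
  obtain ⟨F, hF, hcost⟩ :=
    exists_completion w (clump {u : I.terminals | (u : I.V) ∈ p.1})
  have := I.opt_le_add_sum hK.1 (fun u hu v hv => hK.2 u hu v hv) F hF
  rw [← hI, htmst] at this
  linarith

end SteinerInstance

/-! ### Weighted set families -/

section SetWeight

variable {V : Type*} [Fintype V]

open scoped Classical in
/-- The total weight of the sets with property `P`. -/
def setWeight (y : Finset V → ℝ) (P : Finset V → Prop) : ℝ :=
  ∑ S, if P S then y S else 0

/-- The weight of the sets that the directed component `(X, v)` leaves. -/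
def load (y : Finset V → ℝ) (X : Finset V) (v : V) : ℝ :=
  setWeight y fun S => (∃ u ∈ X, u ∈ S) ∧ v ∉ S

/-- The weight of the sets that contain `u` but not `v`. -/
def separation (y : Finset V → ℝ) (u v : V) : ℝ :=
  setWeight y fun S => u ∈ S ∧ v ∉ S

/-- The weight of the sets that contain `v`. -/
def depth (y : Finset V → ℝ) (v : V) : ℝ :=
  setWeight y fun S => v ∈ S

/-- Any two sets of positive weight are disjoint or nested. -/
def IsLaminar (y : Finset V → ℝ) : Prop :=
  ∀ S T, 0 < y S → 0 < y T → (∃ v ∈ S, v ∈ T) → S ⊆ T ∨ T ⊆ S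

variable {y : Finset V → ℝ}

theorem setWeight_nonneg (hy : ∀ S, 0 ≤ y S) (P : Finset V → Prop) : 0 ≤ setWeight y P := by
  refine Finset.sum_nonneg fun S _ => ?_
  split_ifs
  exacts [hy S, le_rfl]

theorem setWeight_le_add (hy : ∀ S, 0 ≤ y S) {P Q Q' : Finset V → Prop}
    (h : ∀ S, 0 < y S → P S → Q S ∨ Q' S) : setWeight y P ≤ setWeight y Q + setWeight y Q' := by
  rw [setWeight, setWeight, setWeight, ← Finset.sum_add_distrib]
  refine Finset.sum_le_sum fun S _ => ?_
  have h0 := hy S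
  rcases h0.eq_or_lt with hS | hS
  · simp [← hS]
  · have := h S hS
    by_cases h1 : P S <;> by_cases h2 : Q S <;> by_cases h3 : Q' S <;>
      simp_all

theorem setWeight_mono (hy : ∀ S, 0 ≤ y S) {P Q : Finset V → Prop}
    (h : ∀ S, 0 < y S → P S → Q S) : setWeight y P ≤ setWeight y Q := by
  have := setWeight_le_add hy (Q := Q) (Q' := fun _ => False) fun S hS hP => Or.inl (h S hS hP)
  simpa [setWeight] using this

theorem setWeight_add_le (hy : ∀ S, 0 ≤ y S) {P Q Q' : Finset V → Prop}
    (h : ∀ S, Q S → P S) (h' : ∀ S, Q' S → P S ∧ ¬ Q S) :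
    setWeight y Q + setWeight y Q' ≤ setWeight y P := by
  rw [setWeight, setWeight, setWeight, ← Finset.sum_add_distrib]
  refine Finset.sum_le_sum fun S _ => ?_
  have := hy S
  have h1 := h S
  have h2 := h' S
  split_ifs <;> first | (exfalso; tauto) | linarith

theorem le_setWeight (hy : ∀ S, 0 ≤ y S) {P : Finset V → Prop} {S : Finset V} (h : P S) :
    y S ≤ setWeight y P := by
  classical
  have := Finset.single_le_sum (f := fun S => if P S then y S else 0)
    (fun T _ => by split_ifs; exacts [hy T, le_rfl]) (Finset.mem_univ S)
  simpa [setWeight, h] using this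

theorem depth_sub_depth (y : Finset V → ℝ) (u v : V) :
    depth y u - depth y v = separation y u v - separation y v u := by
  classical
  simp only [depth, separation, setWeight, ← Finset.sum_sub_distrib]
  refine Finset.sum_congr rfl fun S _ => ?_
  by_cases hu : u ∈ S <;> by_cases hv : v ∈ S <;> simp [hu, hv]

open scoped Classical in
/-- Moving weight `ε` from `S` and `T` to their intersection and union. -/
def uncross (y : Finset V → ℝ) (S T : Finset V) (ε : ℝ) (U : Finset V) : ℝ :=
  y U + ε * ((if U = S ∩ T then 1 else 0) + (if U = S ∪ T then 1 else 0) -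
    (if U = S then 1 else 0) - (if U = T then 1 else 0))

open scoped Classical in
theorem sum_mul_uncross (a y : Finset V → ℝ) (S T : Finset V) (ε : ℝ) :
    ∑ U, a U * uncross y S T ε U =
      ∑ U, a U * y U + ε * (a (S ∩ T) + a (S ∪ T) - a S - a T) := by
  have h : ∀ U, a U * uncross y S T ε U = a U * y U + ε * ((if U = S ∩ T then a U else 0) +
      (if U = S ∪ T then a U else 0) - (if U = S then a U else 0) -
        (if U = T then a U else 0)) := by
    intro U
    simp only [uncross]
    split_ifs <;> ring
  simp only [h, Finset.sum_add_distrib, ← Finset.mul_sum, Finset.sum_sub_distrib,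
    Finset.sum_ite_eq', Finset.mem_univ, if_true]

open scoped Classical in
theorem load_eq_sum (y : Finset V → ℝ) (X : Finset V) (v : V) :
    load y X v = ∑ S, (if (∃ u ∈ X, u ∈ S) ∧ v ∉ S then 1 else 0) * y S := by
  simp only [load, setWeight, ite_mul, one_mul, zero_mul]
  exact Finset.sum_congr rfl fun S _ => by congr

theorem indicator_add_indicator_sub_le {p q p' q' a b : Prop} [Decidable (p ∧ ¬ (a ∧ b))]
    [Decidable (q ∧ ¬ (a ∨ b))] [Decidable (p' ∧ ¬ a)] [Decidable (q' ∧ ¬ b)]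
    (h : p → p' ∧ q') (h' : q → p' ∨ q') :
    (if p ∧ ¬ (a ∧ b) then (1 : ℝ) else 0) + (if q ∧ ¬ (a ∨ b) then 1 else 0) -
      (if p' ∧ ¬ a then 1 else 0) - (if q' ∧ ¬ b then 1 else 0) ≤ 0 := by
  split_ifs <;> first | (exfalso; tauto) | norm_num

/-- Uncrossing does not increase loads: for fixed `(X, v)`, being left by `(X, v)` is a
submodular property of a set. -/
theorem load_uncross_le (y : Finset V → ℝ) (S T : Finset V) {ε : ℝ} (hε : 0 ≤ ε) (X : Finset V)
    (v : V) : load (uncross y S T ε) X v ≤ load y X v := by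
  classical
  rw [load_eq_sum, load_eq_sum, sum_mul_uncross]
  have : (if (∃ u ∈ X, u ∈ S ∩ T) ∧ v ∉ S ∩ T then (1 : ℝ) else 0) +
      (if (∃ u ∈ X, u ∈ S ∪ T) ∧ v ∉ S ∪ T then 1 else 0) -
      (if (∃ u ∈ X, u ∈ S) ∧ v ∉ S then 1 else 0) -
      (if (∃ u ∈ X, u ∈ T) ∧ v ∉ T then 1 else 0) ≤ 0 := by
    have h1 : (∃ u ∈ X, u ∈ S ∩ T) → (∃ u ∈ X, u ∈ S) ∧ (∃ u ∈ X, u ∈ T) := by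
      rintro ⟨u, hu, huST⟩
      rw [Finset.mem_inter] at huST
      exact ⟨⟨u, hu, huST.1⟩, ⟨u, hu, huST.2⟩⟩
    have h2 : (∃ u ∈ X, u ∈ S ∪ T) → (∃ u ∈ X, u ∈ S) ∨ (∃ u ∈ X, u ∈ T) := by
      rintro ⟨u, hu, huST⟩
      rcases Finset.mem_union.1 huST with h | h
      exacts [Or.inl ⟨u, hu, h⟩, Or.inr ⟨u, hu, h⟩]
    simp only [Finset.mem_inter (a := v), Finset.mem_union (a := v)]
    exact indicator_add_indicator_sub_le h1 h2
  nlinarith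

end SetWeight

namespace SteinerInstance

variable (I : SteinerInstance)

/-! ### Laminar dual solutions of the hypergraphic relaxation -/

/-- Feasible solutions of the linear program dual to the hypergraphic relaxation. -/
structure IsHypDual (r : I.V) (y : Finset I.V → ℝ) : Prop where
  nonneg : ∀ S, 0 ≤ y S
  eq_zero : ∀ S, ¬ (S.Nonempty ∧ S ⊆ I.terminals ∧ r ∉ S) → y S = 0
  load_le : ∀ X ⊆ I.terminals, ∀ v ∈ X, load y X v ≤ I.connectCost X

theorem IsHypDual.of_pos {r : I.V} {y : Finset I.V → ℝ} (hy : I.IsHypDual r y) {S : Finset I.V}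
    (hS : 0 < y S) : S.Nonempty ∧ S ⊆ I.terminals ∧ r ∉ S := by
  by_contra h
  exact hS.ne' (hy.eq_zero S h)

theorem IsHypDual.sum_eq_load {r : I.V} {y : Finset I.V → ℝ} (hy : I.IsHypDual r y) :
    ∑ S, y S = load y I.terminals r := by
  classical
  refine Finset.sum_congr rfl fun S _ => ?_
  split_ifs with h
  · rfl
  · refine hy.eq_zero S fun h' => h ⟨?_, h'.2.2⟩
    obtain ⟨u, hu⟩ := h'.1
    exact ⟨u, h'.2.1 hu, hu⟩

theorem exists_isHypDual {r : I.V} (hr : r ∈ I.terminals) :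
    ∃ y, I.IsHypDual r y ∧ I.hyp r ≤ ∑ S, y S := by
  classical
  let ι := {S : Finset I.V // S.Nonempty ∧ S ⊆ I.terminals ∧ r ∉ S}
  obtain ⟨y, hy0, hyA, hysum⟩ := exists_packing_of_covering_bound
    (fun (S : ι) (p : Finset I.V × I.V) => if p ∈ I.leaving S.1 then (1 : ℝ) else 0)
    (fun S p => by split_ifs <;> norm_num)
    (fun S => ⟨(I.terminals, r), by
      obtain ⟨t, ht⟩ := S.2.1
      have : (I.terminals, r) ∈ I.leaving S.1 := I.mem_leaving.2
        ⟨I.mem_directedComponents.2 ⟨subset_rfl, hr⟩,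
          ⟨t, Finset.mem_inter.2 ⟨S.2.2.1 ht, ht⟩⟩, S.2.2.2⟩
      simp [this]⟩)
    (fun p => if p ∈ I.directedComponents then I.connectCost p.1 else 0)
    (fun p => by
      split_ifs with h
      exacts [I.connectCost_nonneg (I.mem_directedComponents.1 h).1, le_rfl])
    (I.hyp r) (fun x hx hcov => by
      have hfeas : I.HypFeasible r x := by
        refine ⟨fun p _ => hx p, fun S h1 h2 h3 => ?_⟩
        simpa using hcov ⟨S, h1, h2, h3⟩
      simpa using I.hyp_le hfeas)
  have hext : ∀ (P : Finset I.V → Prop),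
      ∑ S : ι, (if P S.1 then y S else 0) =
        setWeight (fun S => if h : S.Nonempty ∧ S ⊆ I.terminals ∧ r ∉ S then y ⟨S, h⟩ else 0)
          P := by
    intro P
    refine Fintype.sum_of_injective Subtype.val Subtype.val_injective _ _ (fun S hS => ?_)
      fun S => ?_
    · have : ¬ (S.Nonempty ∧ S ⊆ I.terminals ∧ r ∉ S) := fun h => hS ⟨⟨S, h⟩, rfl⟩
      simp only [dif_neg this, ite_self]
    · simp only [dif_pos S.2]
  refine ⟨fun S => if h : S.Nonempty ∧ S ⊆ I.terminals ∧ r ∉ S then y ⟨S, h⟩ else 0,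
    ⟨fun S => ?_, fun S hS => dif_neg hS, fun X hX v hv => ?_⟩, ?_⟩
  · split_ifs
    exacts [hy0 _, le_rfl]
  · have hmem : (X, v) ∈ I.directedComponents := I.mem_directedComponents.2 ⟨hX, hv⟩
    have := hyA (X, v)
    rw [if_pos hmem] at this
    rw [load, ← hext]
    refine le_of_eq_of_le (Finset.sum_congr rfl fun S _ => ?_) this
    have hiff : (X, v) ∈ I.leaving S.1 ↔ (∃ u ∈ X, u ∈ S.1) ∧ v ∉ S.1 := by
      rw [mem_leaving]
      simp [hmem, Finset.Nonempty]
    simp only [hiff, ite_mul, one_mul, zero_mul]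
    congr
  · have := hext fun _ => True
    simp only [setWeight, if_true] at this
    exact this ▸ hysum

/-- Among the dual solutions of sufficient value, one that maximizes `∑ y S * |S| ^ 2` is laminar,
as uncrossing increases this sum. -/
theorem exists_isLaminar_isHypDual {r : I.V} (hr : r ∈ I.terminals) :
    ∃ y, I.IsHypDual r y ∧ IsLaminar y ∧ I.hyp r ≤ ∑ S, y S := by
  classical
  set Z : Set (Finset I.V → ℝ) := {y | I.IsHypDual r y ∧ I.hyp r ≤ ∑ S, y S} with hZ
  have hZne : Z.Nonempty := I.exists_isHypDual hr
  have hZc : IsCompact Z := by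
    refine (isCompact_Icc (a := 0) (b := fun _ => I.connectCost I.terminals)).of_isClosed_subset
      ?_ ?_
    · have : Z = {y | ∀ S, 0 ≤ y S} ∩
          ({y | ∀ S, ¬ (S.Nonempty ∧ S ⊆ I.terminals ∧ r ∉ S) → y S = 0} ∩
          ({y | ∀ X ⊆ I.terminals, ∀ v ∈ X, load y X v ≤ I.connectCost X} ∩
            {y | I.hyp r ≤ ∑ S, y S})) := by
        ext y
        exact ⟨fun h => ⟨h.1.1, h.1.2, h.1.3, h.2⟩, fun h => ⟨⟨h.1, h.2.1, h.2.2.1⟩, h.2.2.2⟩⟩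
      rw [this]
      have hc : ∀ S, Continuous fun y : Finset I.V → ℝ => y S := fun S => continuous_apply S
      simp only [Set.ofPred_forall]
      refine (isClosed_iInter fun S => isClosed_le continuous_const (hc S)).inter
        ((isClosed_iInter fun S => isClosed_iInter fun _ =>
          isClosed_eq (hc S) continuous_const).inter
        ((isClosed_iInter fun X => isClosed_iInter fun _ => isClosed_iInter fun v =>
          isClosed_iInter fun _ => ?_).inter (isClosed_le continuous_const ?_)))
      · simp only [load_eq_sum]
        exact isClosed_le (by fun_prop) continuous_const
      · fun_prop
    · rintro y ⟨hy, -⟩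
      refine ⟨fun S => hy.nonneg S, fun S => ?_⟩
      by_cases hS : S.Nonempty ∧ S ⊆ I.terminals ∧ r ∉ S
      · obtain ⟨u, hu⟩ := hS.1
        exact (le_setWeight hy.nonneg ⟨⟨u, hS.2.1 hu, hu⟩, hS.2.2⟩).trans
          (hy.load_le _ subset_rfl r hr)
      · rw [hy.eq_zero S hS]
        exact I.connectCost_nonneg subset_rfl
  obtain ⟨y, ⟨hy, hsum⟩, hmax⟩ := hZc.exists_isMaxOn
    (f := fun y : Finset I.V → ℝ => ∑ S, (S.card : ℝ) ^ 2 * y S) hZne (by fun_prop)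
  refine ⟨y, hy, ?_, hsum⟩
  rintro S T hS hT ⟨t, htS, htT⟩
  by_contra! hcross
  obtain ⟨hST, hTS⟩ := hcross
  set ε := min (y S) (y T) with hε
  have hε0 : 0 < ε := lt_min hS hT
  have hne : S ≠ T := by
    rintro rfl
    exact hST subset_rfl
  have hmem : uncross y S T ε ∈ Z := by
    refine ⟨⟨fun U => ?_, fun U hU => ?_, fun X hX v hv => ?_⟩, ?_⟩
    · have h0 := hy.nonneg U
      by_cases hUS : U = S
      · subst hUS
        have : ε ≤ y U := min_le_left _ _
        simp only [uncross, if_true, if_neg hne]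
        split_ifs <;> nlinarith
      · by_cases hUT : U = T
        · subst hUT
          have : ε ≤ y U := min_le_right _ _
          simp only [uncross, if_true, if_neg hUS]
          split_ifs <;> nlinarith
        · simp only [uncross, if_neg hUS, if_neg hUT]
          split_ifs <;> nlinarith
    · obtain ⟨-, hSR, hrS⟩ := hy.of_pos I hS
      obtain ⟨-, hTR, hrT⟩ := hy.of_pos I hT
      have h1 : U ≠ S := by
        rintro rfl
        exact hS.ne' (hy.eq_zero _ hU)
      have h2 : U ≠ T := by
        rintro rfl
        exact hT.ne' (hy.eq_zero _ hU)
      have h3 : U ≠ S ∩ T := by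
        rintro rfl
        exact hU ⟨⟨t, Finset.mem_inter.2 ⟨htS, htT⟩⟩, Finset.inter_subset_left.trans hSR,
          fun h => hrS (Finset.mem_inter.1 h).1⟩
      have h4 : U ≠ S ∪ T := by
        rintro rfl
        exact hU ⟨⟨t, Finset.mem_union_left _ htS⟩, Finset.union_subset hSR hTR,
          fun h => (Finset.mem_union.1 h).elim hrS hrT⟩
      simp [uncross, h1, h2, h3, h4, hy.eq_zero U hU]
    · exact (load_uncross_le y S T hε0.le X v).trans (hy.load_le X hX v hv)
    · have := sum_mul_uncross (fun _ => (1 : ℝ)) y S T ε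
      simp only [one_mul] at this
      rw [this]
      linarith
  have hle := hmax hmem
  simp only [Set.mem_ofPred_eq] at hle
  rw [sum_mul_uncross (fun U => (U.card : ℝ) ^ 2)] at hle
  have h1 : ((S ∪ T).card : ℝ) + (S ∩ T).card = S.card + T.card := by
    exact_mod_cast Finset.card_union_add_card_inter S T
  have h2 : (S.card : ℝ) < (S ∪ T).card := by
    exact_mod_cast Finset.card_lt_card (Finset.ssubset_iff_subset_ne.2
      ⟨Finset.subset_union_left, fun h => hTS (Finset.union_eq_left.1 h.symm)⟩)
  have h3 : (T.card : ℝ) < (S ∪ T).card := by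
    exact_mod_cast Finset.card_lt_card (Finset.ssubset_iff_subset_ne.2
      ⟨Finset.subset_union_right, fun h => hST (Finset.union_eq_right.1 h.symm)⟩)
  have hi : ((S ∩ T).card : ℝ) = S.card + T.card - (S ∪ T).card := by linarith
  have hpos : 0 < ((S ∩ T).card : ℝ) ^ 2 + ((S ∪ T).card : ℝ) ^ 2 - (S.card : ℝ) ^ 2 -
      (T.card : ℝ) ^ 2 := by
    rw [hi]
    nlinarith [mul_pos (sub_pos.2 h2) (sub_pos.2 h3)]
  have := mul_pos hε0 hpos
  linarith

theorem exists_pos_le_connectCost : ∃ m : ℝ, 0 < m ∧ ∀ X ⊆ I.terminals, ∀ u ∈ X, ∀ v ∈ X, u ≠ v →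
    m ≤ I.connectCost X := by
  obtain ⟨m, hm, hmc⟩ := I.exists_pos_le_cost
  refine ⟨m, hm, fun X hX u hu v hv huv => I.le_connectCost hX fun K hK => ?_⟩
  obtain ⟨e, he⟩ : K.Nonempty := by
    rw [Set.nonempty_iff_ne_empty]
    rintro rfl
    have := hK.2 u hu v hv
    rw [SimpleGraph.fromEdgeSet_empty, SimpleGraph.reachable_bot] at this
    exact huv this
  exact (hmc e (hK.1 he)).trans (I.le_edgeCost_of_mem hK.1 he)

/-- At an arbitrarily small loss, the dual solution can be taken to be positive on all singletons
other than the root. -/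
theorem exists_isLaminar_isHypDual_pos {r : I.V} (hr : r ∈ I.terminals) {γ : ℝ}
    (hγ : γ < I.hyp r) : ∃ y, I.IsHypDual r y ∧ IsLaminar y ∧ γ ≤ ∑ S, y S ∧
      ∀ t ∈ I.terminals, t ≠ r → 0 < y {t} := by
  classical
  obtain ⟨y, hy, hlam, hsum⟩ := I.exists_isLaminar_isHypDual hr
  obtain ⟨m, hm, hmc⟩ := I.exists_pos_le_connectCost
  have hy0 : 0 ≤ ∑ S, y S := Finset.sum_nonneg fun S _ => hy.nonneg S
  set σ := ∑ S, y S with hσ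
  set δ := (σ - γ) / (σ + 1 + (σ - γ)) with hδ
  have hgap : 0 < σ - γ := by linarith
  have hden : 0 < σ + 1 + (σ - γ) := by linarith
  have hδ0 : 0 < δ := div_pos hgap hden
  have hδ1 : δ < 1 := by
    rw [hδ, div_lt_one hden]
    linarith
  have hδσ : δ * σ ≤ σ - γ := by
    rw [hδ, div_mul_eq_mul_div, div_le_iff₀ hden]
    nlinarith
  set k : ℝ := (Fintype.card (Finset I.V) : ℝ) with hk
  have hkpos : 0 < k := by
    have : 0 < Fintype.card (Finset I.V) := Fintype.card_pos
    rw [hk]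
    exact_mod_cast this
  set ε := δ * m / k with hε
  have hε0 : 0 < ε := by positivity
  let z : Finset I.V → ℝ := fun S => if ∃ t ∈ I.terminals, t ≠ r ∧ S = {t} then ε else 0
  have hz0 : ∀ S, 0 ≤ z S := by
    intro S
    simp only [z]
    split_ifs
    exacts [hε0.le, le_rfl]
  have hzε : ∀ S, z S ≤ ε := by
    intro S
    simp only [z]
    split_ifs
    exacts [le_rfl, hε0.le]
  have hzpos : ∀ S, z S ≠ 0 → ∃ t ∈ I.terminals, t ≠ r ∧ S = {t} := by
    intro S hS
    by_contra h
    exact hS (if_neg h)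
  have hload : ∀ X v, load (fun S => (1 - δ) * y S + z S) X v =
      (1 - δ) * load y X v + load z X v := by
    intro X v
    simp only [load_eq_sum, Finset.mul_sum, ← Finset.sum_add_distrib]
    exact Finset.sum_congr rfl fun S _ => by ring
  have hy'pos : ∀ S, 0 < (1 - δ) * y S + z S → 0 < y S ∨ ∃ t, S = {t} := by
    intro S hS
    rcases (hy.nonneg S).eq_or_lt with h | h
    · right
      rw [← h, mul_zero, zero_add] at hS
      obtain ⟨t, -, -, ht⟩ := hzpos S hS.ne'
      exact ⟨t, ht⟩
    · exact Or.inl h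
  refine ⟨fun S => (1 - δ) * y S + z S, ⟨fun S => ?_, fun S hS => ?_, fun X hX v hv => ?_⟩,
    ?_, ?_, fun t ht htr => ?_⟩
  · have := mul_nonneg (sub_nonneg.2 hδ1.le) (hy.nonneg S)
    linarith [hz0 S]
  · have : z S = 0 := by
      by_contra h
      obtain ⟨t, ht, htr, rfl⟩ := hzpos S h
      exact hS ⟨Finset.singleton_nonempty t, Finset.singleton_subset_iff.2 ht,
        by simpa using htr.symm⟩
    simp [this, hy.eq_zero S hS]
  · rw [hload]
    have hlo := mul_le_mul_of_nonneg_left (hy.load_le X hX v hv) (sub_nonneg.2 hδ1.le)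
    by_cases hX1 : ∃ u ∈ X, u ≠ v
    · obtain ⟨u, hu, huv⟩ := hX1
      have h1 : load z X v ≤ δ * m := by
        calc load z X v ≤ ∑ _S : Finset I.V, ε := Finset.sum_le_sum fun S _ => by
              split_ifs
              exacts [hzε S, hε0.le]
          _ = δ * m := by
              rw [Finset.sum_const, nsmul_eq_mul, Finset.card_univ, hε, ← hk]
              field_simp
      have h2 := mul_le_mul_of_nonneg_left (hmc X hX u hu v hv huv) hδ0.le
      linarith
    · have h0 : ∀ y' : Finset I.V → ℝ, load y' X v = 0 := by
        intro y'
        refine Finset.sum_eq_zero fun S _ => if_neg ?_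
        rintro ⟨⟨u, hu, huS⟩, hvS⟩
        exact hX1 ⟨u, hu, by rintro rfl; exact hvS huS⟩
      rw [h0, h0, mul_zero, zero_add]
      exact I.connectCost_nonneg hX
  · rintro S T hS hT ⟨t, htS, htT⟩
    rcases hy'pos S hS with h | ⟨s, rfl⟩
    · rcases hy'pos T hT with h' | ⟨s, rfl⟩
      · exact hlam S T h h' ⟨t, htS, htT⟩
      · rw [Finset.mem_singleton] at htT
        exact Or.inr (Finset.singleton_subset_iff.2 (htT ▸ htS))
    · rw [Finset.mem_singleton] at htS
      exact Or.inl (Finset.singleton_subset_iff.2 (htS ▸ htT))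
  · rw [Finset.sum_add_distrib, ← Finset.mul_sum, ← hσ]
    have := Finset.sum_nonneg fun S (_ : S ∈ Finset.univ) => hz0 S
    linarith
  · have hzt : z {t} = ε := if_pos ⟨t, ht, htr, rfl⟩
    have := mul_nonneg (sub_nonneg.2 hδ1.le) (hy.nonneg {t})
    simp only [hzt]
    linarith

end SteinerInstance

/-! ### Splitting an edge set along a union of components -/

theorem joins_meeting_of_joins {α : Type*} {K : Set (Sym2 α)} {P : α → Prop}
    (hP : ∀ u v, joins K u v → P u → P v) {u v : α} (huv : joins K u v) (hu : P u) :
    joins {e ∈ K | ∃ x ∈ e, P x} u v := by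
  have hle : joins K ≤
      { r := fun u v => (P u ↔ P v) ∧ (P u → joins {e ∈ K | ∃ x ∈ e, P x} u v)
        iseqv := ⟨fun x => ⟨Iff.rfl, fun _ => Setoid.refl' _ x⟩,
          fun h => ⟨h.1.symm, fun h' => Setoid.symm' _ (h.2 (h.1.2 h'))⟩,
          fun h k => ⟨h.1.trans k.1, fun h' => Setoid.trans' _ (h.2 h') (k.2 (h.1.1 h'))⟩⟩ } := by
    rw [joins_le_iff]
    intro a b hab
    have hj := joins_rel_of_mem hab
    exact ⟨⟨hP a b hj, hP b a (Setoid.symm' _ hj)⟩,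
      fun ha => joins_rel_of_mem ⟨hab, a, Sym2.mem_mk_left a b, ha⟩⟩
  exact (hle huv).2 hu

theorem disjoint_meeting {α : Type*} {K : Set (Sym2 α)} {P : α → Prop}
    (hP : ∀ u v, joins K u v → P u → P v) :
    Disjoint {e ∈ K | ∃ x ∈ e, P x} {e ∈ K | ∃ x ∈ e, ¬ P x} := by
  rw [Set.disjoint_left]
  rintro e ⟨heK, x, hx, hPx⟩ ⟨-, z, hz, hPz⟩
  by_cases hxz : x = z
  · exact hPz (hxz ▸ hPx)
  · have : e = s(x, z) := (Sym2.mem_and_mem_iff hxz).1 ⟨hx, hz⟩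
    exact hPz (hP x z (joins_rel_of_mem (this ▸ heK)) hPx)

namespace SteinerInstance

variable (I : SteinerInstance)

/-! ### Adding terminal edges that make an instance MST-optimal -/

/-- The cost of the edge between two terminals that a laminar dual solution prescribes: the larger
of the weights of the sets separating `u` from `v` and `v` from `u`. -/
def moatCost {V : Type*} [Fintype V] (y : Finset V → ℝ) (e : Sym2 V) : ℝ :=
  Sym2.lift ⟨fun u v => max (separation y u v) (separation y v u), fun _ _ => max_comm _ _⟩ e

/-- The edge `e` joins two terminals. -/
def IsTerminalEdge (e : Sym2 I.V) : Prop := ∀ v ∈ e, v ∈ I.terminals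

theorem isTerminalEdge_mk {u v : I.V} :
    I.IsTerminalEdge s(u, v) ↔ u ∈ I.terminals ∧ v ∈ I.terminals := by
  simp [IsTerminalEdge]

/-- The given graph with all edges between terminals added. -/
def augmentedGraph : SimpleGraph I.V where
  Adj u v := I.graph.Adj u v ∨ (u ≠ v ∧ u ∈ I.terminals ∧ v ∈ I.terminals)
  symm := ⟨fun _ _ h => h.imp SimpleGraph.Adj.symm fun h => ⟨h.1.symm, h.2.2, h.2.1⟩⟩
  loopless := ⟨fun _ h => h.elim (I.graph.irrefl) fun h => h.1 rfl⟩

theorem le_augmentedGraph : I.graph ≤ I.augmentedGraph := fun _ _ h => Or.inl h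

open scoped Classical in
/-- The costs in the augmented instance: edges between terminals, old or new, get the cost
prescribed by `y`. -/
def augmentedCost (y : Finset I.V → ℝ) (e : Sym2 I.V) : ℝ :=
  if I.IsTerminalEdge e then moatCost y e else I.cost e

theorem IsHypDual.augmentedCost_pos {r : I.V} {y : Finset I.V → ℝ} (hy : I.IsHypDual r y)
    (hpos : ∀ t ∈ I.terminals, t ≠ r → 0 < y {t}) (e : Sym2 I.V)
    (he : e ∈ I.augmentedGraph.edgeSet) : 0 < I.augmentedCost y e := by
  classical
  induction e with
  | _ u v =>
    rw [augmentedCost]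
    split_ifs with h
    · obtain ⟨hu, hv⟩ := I.isTerminalEdge_mk.1 h
      have huv : u ≠ v := SimpleGraph.Adj.ne (G := I.augmentedGraph) he
      by_cases hur : u = r
      · have hv' := hpos v hv (by rintro rfl; exact huv hur)
        exact lt_max_of_lt_right (hv'.trans_le (le_setWeight hy.nonneg (by simpa using huv)))
      · exact lt_max_of_lt_left ((hpos u hu hur).trans_le
          (le_setWeight hy.nonneg (by simpa using huv.symm)))
    · rcases he with he | he
      · exact I.cost_pos _ he
      · exact absurd (I.isTerminalEdge_mk.2 he.2) h

/-- The instance obtained by adding all edges between terminals, at the costs prescribed by a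
dual solution `y`. -/
abbrev augment (y : Finset I.V → ℝ)
    (hpos : ∀ e ∈ I.augmentedGraph.edgeSet, 0 < I.augmentedCost y e) : SteinerInstance where
  V := I.V
  graph := I.augmentedGraph
  cost := I.augmentedCost y
  cost_pos := hpos
  terminals := I.terminals
  two_le_card := I.two_le_card
  terminals_reachable := fun s hs t ht =>
    (I.terminals_reachable s hs t ht).mono I.le_augmentedGraph

variable {I} {r : I.V} {y : Finset I.V → ℝ}

theorem IsHypDual.augmentedCost_le (hy : I.IsHypDual r y) {e : Sym2 I.V}
    (he : e ∈ I.graph.edgeSet) : I.augmentedCost y e ≤ I.cost e := by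
  classical
  induction e with
  | _ u v =>
    rw [augmentedCost]
    split_ifs with h
    · obtain ⟨hu, hv⟩ := I.isTerminalEdge_mk.1 h
      have hX : ({u, v} : Finset I.V) ⊆ I.terminals := by
        intro x hx
        rcases Finset.mem_insert.1 hx with rfl | hx
        · exact hu
        · exact Finset.mem_singleton.1 hx ▸ hv
      have hcost : I.connectCost {u, v} ≤ I.cost s(u, v) := by
        have hsub : ({s(u, v)} : Set (Sym2 I.V)) ⊆ I.graph.edgeSet :=
          Set.singleton_subset_iff.2 he
        have hone : I.edgeCost {s(u, v)} = I.cost s(u, v) := by simp [edgeCost_eq_sum_ite]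
        refine hone ▸ I.connectCost_le ⟨hsub, ?_⟩
        have hj : joins {s(u, v)} u v := joins_rel_of_mem rfl
        have := clump_le_iff.1 (clump_pair_le_iff.2 hj)
        intro a ha b hb
        exact this a (by simpa using ha) b (by simpa using hb)
      refine max_le (le_trans ?_ ((hy.load_le _ hX v (by simp)).trans hcost))
        (le_trans ?_ ((hy.load_le _ hX u (by simp)).trans hcost))
      · exact setWeight_mono hy.nonneg fun S _ h => ⟨⟨u, by simp, h.1⟩, h.2⟩
      · exact setWeight_mono hy.nonneg fun S _ h => ⟨⟨v, by simp, h.1⟩, h.2⟩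
    · exact le_rfl

/-- The dual solution remains feasible in the augmented instance. By induction on the number of
edges between terminals: removing one splits a component into two parts, and a set left by the
component is left by one of the parts or separates the ends of the removed edge. -/
theorem IsHypDual.load_le_augmented (hy : I.IsHypDual r y)
    (hpos : ∀ e ∈ I.augmentedGraph.edgeSet, 0 < I.augmentedCost y e) :
    ∀ (n : ℕ) (K : Set (Sym2 I.V)), {e ∈ K | I.IsTerminalEdge e}.ncard ≤ n →
      K ⊆ I.augmentedGraph.edgeSet → ∀ X ⊆ I.terminals, ∀ v ∈ X, (∀ u ∈ X, joins K u v) →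
        load y X v ≤ (I.augment y hpos).edgeCost K := by
  classical
  intro n
  induction n with
  | zero =>
    intro K hKn hK X hX v hv hXv
    have hnot : ∀ e ∈ K, ¬ I.IsTerminalEdge e := by
      intro e he h
      have h0 := (Set.ncard_eq_zero (Set.toFinite _)).1 (Nat.le_zero.1 hKn)
      exact (h0 ▸ (⟨he, h⟩ : e ∈ {e ∈ K | I.IsTerminalEdge e}) : e ∈ (∅ : Set (Sym2 I.V)))
    have hKI : K ⊆ I.graph.edgeSet := by
      intro e he
      have he' := hK he
      have hn := hnot e he
      induction e with
      | _ a b =>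
        rcases he' with he' | he'
        · exact he'
        · exact absurd (I.isTerminalEdge_mk.2 he'.2) hn
    have hcost : (I.augment y hpos).edgeCost K = I.edgeCost K := by
      refine Finset.sum_congr rfl fun e he => ?_
      exact if_neg (hnot e (Finset.mem_filter.1 he).2)
    rw [hcost]
    exact (hy.load_le X hX v hv).trans (I.connectCost_le
      ⟨hKI, fun a ha b hb => Setoid.trans' _ (hXv a ha) (Setoid.symm' _ (hXv b hb))⟩)
  | succ n ih =>
    intro K hKn hK X hX v hv hXv
    by_cases hT : ∃ e ∈ K, I.IsTerminalEdge e
    swap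
    · refine ih K ?_ hK X hX v hv hXv
      have : {e ∈ K | I.IsTerminalEdge e} = ∅ := by
        ext e
        exact ⟨fun h => hT ⟨e, h.1, h.2⟩, False.elim⟩
      simp [this]
    obtain ⟨e, heK, heT⟩ := hT
    have hcount : ∀ L ⊆ K \ {e}, {e ∈ L | I.IsTerminalEdge e}.ncard ≤ n := by
      intro L hL
      have hlt : {e ∈ L | I.IsTerminalEdge e}.ncard < {e ∈ K | I.IsTerminalEdge e}.ncard := by
        refine Set.ncard_lt_ncard ⟨fun f hf => ⟨(hL hf.1).1, hf.2⟩, fun h => ?_⟩ (Set.toFinite _)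
        exact (hL (h ⟨heK, heT⟩).1).2 rfl
      omega
    have hK0 : K \ {e} ⊆ I.augmentedGraph.edgeSet := Set.sdiff_subset.trans hK
    by_cases hconn : ∀ u ∈ X, joins (K \ {e}) u v
    · exact (ih _ (hcount _ subset_rfl) hK0 X hX v hv hconn).trans
        ((I.augment y hpos).edgeCost_mono Set.sdiff_subset hK)
    have hins : insert e (K \ {e}) = K := by
      rw [Set.insert_sdiff_singleton, Set.insert_eq_of_mem heK]
    -- Name the ends of `e` so that `b` is on the side of `v`.
    obtain ⟨a, b, rfl, hbv⟩ : ∃ a b, e = s(a, b) ∧ joins (K \ {e}) b v := by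
      push Not at hconn
      obtain ⟨u, hu, huv⟩ := hconn
      induction e with
      | _ a b =>
        have h := hXv u hu
        rw [← hins, joins_insert] at h
        rcases sup_clump_pair_rel_iff.1 h with h | ⟨-, h⟩ | ⟨-, h⟩
        · exact absurd h huv
        · exact ⟨a, b, rfl, h⟩
        · exact ⟨b, a, Sym2.eq_swap, h⟩
    obtain ⟨ha, hb⟩ := I.isTerminalEdge_mk.1 heT
    set K0 := K \ {s(a, b)} with hK0def
    have hside : ∀ u ∈ X, joins K0 u b ∨ joins K0 u a := by
      intro u hu
      have h := hXv u hu
      rw [← hins, joins_insert] at h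
      rcases sup_clump_pair_rel_iff.1 h with h | ⟨h, -⟩ | ⟨h, -⟩
      · exact Or.inl (Setoid.trans' _ h (Setoid.symm' _ hbv))
      · exact Or.inr h
      · exact Or.inl h
    let P : I.V → Prop := fun x => joins K0 x b
    have hP : ∀ u v, joins K0 u v → P u → P v := fun u v huv hu =>
      Setoid.trans' _ (Setoid.symm' _ huv) hu
    have hP' : ∀ u v, joins K0 u v → ¬ P u → ¬ P v := fun u v huv hu hv =>
      hu (hP v u (Setoid.symm' _ huv) hv)
    set K1 : Set (Sym2 I.V) := {e ∈ K0 | ∃ x ∈ e, P x} with hK1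
    set K2 : Set (Sym2 I.V) := {e ∈ K0 | ∃ x ∈ e, ¬ P x} with hK2
    have hK1K : K1 ⊆ K0 := fun e he => he.1
    have hK2K : K2 ⊆ K0 := fun e he => he.1
    have hdisj : Disjoint K1 K2 := disjoint_meeting hP
    have h1 : load y (insert b {u ∈ X | P u}) v ≤ (I.augment y hpos).edgeCost K1 := by
      refine ih K1 (hcount K1 hK1K) (hK1K.trans hK0) _ ?_ v ?_ ?_
      · exact Finset.insert_subset hb ((Finset.filter_subset _ _).trans hX)
      · exact Finset.mem_insert_of_mem (Finset.mem_filter.2 ⟨hv, Setoid.symm' _ hbv⟩)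
      · intro u hu
        rcases Finset.mem_insert.1 hu with rfl | hu
        · exact joins_meeting_of_joins hP hbv (Setoid.refl' _ u)
        · have hPu := (Finset.mem_filter.1 hu).2
          exact joins_meeting_of_joins hP (Setoid.trans' _ hPu hbv) hPu
    have h2 : load y (insert a {u ∈ X | ¬ P u}) a ≤ (I.augment y hpos).edgeCost K2 := by
      refine ih K2 (hcount K2 hK2K) (hK2K.trans hK0) _ ?_ a (Finset.mem_insert_self _ _) ?_
      · exact Finset.insert_subset ha ((Finset.filter_subset _ _).trans hX)
      · intro u hu
        rcases Finset.mem_insert.1 hu with rfl | hu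
        · exact Setoid.refl' _ u
        · obtain ⟨huX, hPu⟩ := Finset.mem_filter.1 hu
          exact joins_meeting_of_joins hP' ((hside u huX).resolve_left hPu) hPu
    have h3 : separation y a b ≤ (I.augment y hpos).edgeCost {s(a, b)} := by
      have hone : (I.augment y hpos).edgeCost {s(a, b)} = I.augmentedCost y s(a, b) := by
        simp [edgeCost_eq_sum_ite]
      rw [hone, augmentedCost, if_pos heT]
      exact le_max_left _ _
    have hload : load y X v ≤ load y (insert b {u ∈ X | P u}) v +
        (load y (insert a {u ∈ X | ¬ P u}) a + separation y a b) := by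
      refine (setWeight_le_add hy.nonneg (Q' := fun S =>
        ((∃ u ∈ insert a ({u ∈ X | ¬ P u} : Finset I.V), u ∈ S) ∧ a ∉ S) ∨ (a ∈ S ∧ b ∉ S))
        ?_).trans (add_le_add le_rfl (setWeight_le_add hy.nonneg fun S _ h => h))
      rintro S - ⟨⟨u, hu, huS⟩, hvS⟩
      by_cases hbS : b ∈ S
      · exact Or.inl ⟨⟨b, Finset.mem_insert_self _ _, hbS⟩, hvS⟩
      · by_cases hPu : P u
        · exact Or.inl ⟨⟨u, Finset.mem_insert_of_mem (Finset.mem_filter.2 ⟨hu, hPu⟩), huS⟩, hvS⟩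
        · by_cases haS : a ∈ S
          · exact Or.inr (Or.inr ⟨haS, hbS⟩)
          · exact Or.inr (Or.inl
              ⟨⟨u, Finset.mem_insert_of_mem (Finset.mem_filter.2 ⟨hu, hPu⟩), huS⟩, haS⟩)
    have hsplit : (I.augment y hpos).edgeCost K1 + ((I.augment y hpos).edgeCost K2 +
        (I.augment y hpos).edgeCost {s(a, b)}) ≤ (I.augment y hpos).edgeCost K := by
      have hK0e : ∀ L ⊆ K0, Disjoint L {s(a, b)} := fun L hL =>
        Set.disjoint_singleton_right.2 fun h => (hL h).2 rfl
      rw [← (I.augment y hpos).edgeCost_union_of_disjoint (hK0e K2 hK2K),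
        ← (I.augment y hpos).edgeCost_union_of_disjoint (Set.disjoint_union_right.2 ⟨hdisj, hK0e K1 hK1K⟩)]
      refine (I.augment y hpos).edgeCost_mono ?_ hK
      exact Set.union_subset (hK1K.trans Set.sdiff_subset) (Set.union_subset
        (hK2K.trans Set.sdiff_subset) (Set.singleton_subset_iff.2 heK))
    linarith

theorem IsHypDual.sum_le_opt_augment (hy : I.IsHypDual r y) (hr : r ∈ I.terminals)
    (hpos : ∀ e ∈ I.augmentedGraph.edgeSet, 0 < I.augmentedCost y e) :
    ∑ S, y S ≤ (I.augment y hpos).opt := by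
  refine (I.augment y hpos).le_opt fun K hK => ?_
  rw [hy.sum_eq_load]
  exact hy.load_le_augmented hpos _ K le_rfl hK.1 I.terminals subset_rfl r hr
    fun u hu => hK.2 u hu r hr

theorem terminalEdgeCost_augment_le (hy : ∀ S, 0 ≤ y S)
    (hpos : ∀ e ∈ I.augmentedGraph.edgeSet, 0 < I.augmentedCost y e) (u v : I.terminals) :
    (I.augment y hpos).terminalEdgeCost s(u, v) ≤ moatCost y s((u : I.V), (v : I.V)) := by
  classical
  by_cases huv : (u : I.V) = v
  · have h0 : (0 : ℝ) ≤ moatCost y s((u : I.V), (v : I.V)) :=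
      le_max_of_le_left (setWeight_nonneg hy _)
    refine le_trans ?_ h0
    change (I.augment y hpos).dist u v ≤ 0
    rw [← huv]
    refine csInf_le ⟨0, ?_⟩ ⟨SimpleGraph.Walk.nil, by simp [walkCost]⟩
    rintro q ⟨p, rfl⟩
    exact (I.augment y hpos).walkCost_nonneg p
  · have hadj : (I.augment y hpos).graph.Adj (u : I.V) v := Or.inr ⟨huv, u.2, v.2⟩
    have := (I.augment y hpos).dist_le_cost hadj
    refine this.trans (le_of_eq ?_)
    exact if_pos (I.isTerminalEdge_mk.2 ⟨u.2, v.2⟩)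

/-- If no terminal seen so far is deeper than `a`, then by laminarity `a` can be joined to one
of them, or to the root, at the weight of the sets that contain `a` but none of them. -/
theorem IsHypDual.exists_moatCost_le (hy : I.IsHypDual r y) (hlam : IsLaminar y)
    (hr : r ∈ I.terminals) (A : Finset I.terminals) (a : I.terminals)
    (hdeep : ∀ u ∈ A, depth y (u : I.V) ≤ depth y (a : I.V)) :
    ∃ j : I.terminals, (j ∈ A ∨ j = ⟨r, hr⟩) ∧ moatCost y s((a : I.V), (j : I.V)) ≤
      setWeight y fun S => (a : I.V) ∈ S ∧ ¬ ∃ u ∈ A, (u : I.V) ∈ S := by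
  classical
  have key : ∃ j : I.terminals, (j ∈ A ∨ j = ⟨r, hr⟩) ∧
      ∀ S, 0 < y S → (a : I.V) ∈ S → (j : I.V) ∉ S → ¬ ∃ u ∈ A, (u : I.V) ∈ S := by
    rcases Finset.eq_empty_or_nonempty
      ({S | 0 < y S ∧ (a : I.V) ∈ S ∧ ∃ u ∈ A, (u : I.V) ∈ S} : Finset (Finset I.V))
      with hemp | hne
    · refine ⟨⟨r, hr⟩, Or.inr rfl, fun S hS haS _ hA => ?_⟩
      have : S ∈ (∅ : Finset (Finset I.V)) :=
        hemp ▸ Finset.mem_filter.2 ⟨Finset.mem_univ S, hS, haS, hA⟩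
      simp at this
    · obtain ⟨S₀, hS₀, hmin⟩ := Finset.exists_min_image _ Finset.card hne
      obtain ⟨-, hyS₀, haS₀, j, hjA, hjS₀⟩ := Finset.mem_filter.1 hS₀
      refine ⟨j, Or.inl hjA, fun S hS haS hjS hA => ?_⟩
      have hcard := hmin S (Finset.mem_filter.2 ⟨Finset.mem_univ S, hS, haS, hA⟩)
      rcases hlam S S₀ hS hyS₀ ⟨a, haS, haS₀⟩ with h | h
      · exact hjS (Finset.eq_of_subset_of_card_le h hcard ▸ hjS₀)
      · exact hjS (h hjS₀)
  obtain ⟨j, hj, hjS⟩ := key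
  refine ⟨j, hj, ?_⟩
  have hdepth : depth y (j : I.V) ≤ depth y (a : I.V) := by
    rcases hj with hj | rfl
    · exact hdeep j hj
    · have : depth y r = 0 := Finset.sum_eq_zero fun S _ => by
        split_ifs with h
        · exact hy.eq_zero S fun h' => h'.2.2 h
        · rfl
      change depth y r ≤ _
      rw [this]
      exact setWeight_nonneg hy.nonneg _
  have hout : separation y (a : I.V) j ≤
      setWeight y fun S => (a : I.V) ∈ S ∧ ¬ ∃ u ∈ A, (u : I.V) ∈ S :=
    setWeight_mono hy.nonneg fun S hS h => ⟨h.1, hjS S hS h.1 h.2⟩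
  refine max_le hout (le_trans ?_ hout)
  have := depth_sub_depth y (a : I.V) j
  linarith

/-- Joining the terminals one by one, in order of depth, yields a terminal spanning tree that pays
for each set of the laminar family only once. -/
theorem IsHypDual.tmst_augment_le_sum (hy : I.IsHypDual r y) (hlam : IsLaminar y)
    (hr : r ∈ I.terminals)
    (hpos : ∀ e ∈ I.augmentedGraph.edgeSet, 0 < I.augmentedCost y e) :
    (I.augment y hpos).tmst ≤ ∑ S, y S := by
  classical
  set J := I.augment y hpos with hJ
  have key : ∀ A : Finset I.terminals, ∃ F : Finset (Sym2 I.terminals),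
      (∀ u ∈ A, joins (F : Set (Sym2 I.terminals)) u ⟨r, hr⟩) ∧
        ∑ e ∈ F, J.terminalEdgeCost e ≤ setWeight y fun S => ∃ u ∈ A, (u : I.V) ∈ S := by
    intro A
    induction A using Finset.induction_on_max_value
      (fun u : I.terminals => depth y (u : I.V)) with
    | empty => exact ⟨∅, by simp, by simp [setWeight]⟩
    | insert a A haA hdeep ih =>
      obtain ⟨F, hF, hcost⟩ := ih
      obtain ⟨j, hj, hja⟩ := hy.exists_moatCost_le hlam hr A a hdeep
      refine ⟨insert s(a, j) F, fun u hu => ?_, ?_⟩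
      · have hle : joins (F : Set (Sym2 I.terminals)) ≤
            joins ((insert s(a, j) F : Finset _) : Set (Sym2 I.terminals)) :=
          joins_mono (by simp)
        rcases Finset.mem_insert.1 hu with rfl | hu
        · refine Setoid.trans' _ (joins_rel_of_mem (v := j) (by simp)) ?_
          rcases hj with hj | rfl
          · exact hle (hF j hj)
          · exact Setoid.refl' _ _
        · exact hle (hF u hu)
      · have h1 : ∑ e ∈ insert s(a, j) F, J.terminalEdgeCost e ≤
            J.terminalEdgeCost s(a, j) + ∑ e ∈ F, J.terminalEdgeCost e := by
          by_cases h : s(a, j) ∈ F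
          · rw [Finset.insert_eq_of_mem h]
            linarith [J.terminalEdgeCost_nonneg s(a, j)]
          · rw [Finset.sum_insert h]
        have h2 := terminalEdgeCost_augment_le hy.nonneg hpos a j
        have h3 : (setWeight y fun S => ∃ u ∈ A, (u : I.V) ∈ S) +
            (setWeight y fun S => (a : I.V) ∈ S ∧ ¬ ∃ u ∈ A, (u : I.V) ∈ S) ≤
            setWeight y fun S => ∃ u ∈ insert a A, (u : I.V) ∈ S := by
          refine setWeight_add_le hy.nonneg ?_ ?_
          · rintro S ⟨u, hu, huS⟩
            exact ⟨u, Finset.mem_insert_of_mem hu, huS⟩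
          · rintro S ⟨haS, hn⟩
            exact ⟨⟨a, Finset.mem_insert_self _ _, haS⟩, hn⟩
        linarith
  obtain ⟨F, hF, hcost⟩ := key Finset.univ
  refine (J.tmst_le_sum F (top_le_iff.1 fun u v _ => ?_)).trans (hcost.trans ?_)
  · exact Setoid.trans' _ (hF u (Finset.mem_univ _)) (Setoid.symm' _ (hF v (Finset.mem_univ _)))
  · refine Finset.sum_le_sum fun S _ => ?_
    split_ifs
    exacts [le_rfl, hy.nonneg S]

theorem IsHypDual.bcr_augment_le (hy : I.IsHypDual r y) (hr : r ∈ I.terminals)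
    (hpos : ∀ e ∈ I.augmentedGraph.edgeSet, 0 < I.augmentedCost y e) :
    (I.augment y hpos).bcr r ≤ I.bcr r := by
  classical
  refine I.le_bcr hr fun x hx => ?_
  let ι : I.graph.Dart → (I.augment y hpos).graph.Dart := fun d => ⟨d.toProd, Or.inl d.adj⟩
  have hι : Function.Injective ι := by
    intro d d' h
    have := congrArg SimpleGraph.Dart.toProd h
    exact SimpleGraph.Dart.ext _ _ this
  let x' : (I.augment y hpos).graph.Dart → ℝ := Function.extend ι x fun _ => 0
  have hx'ι : ∀ d, x' (ι d) = x d := fun d => hι.extend_apply x _ d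
  have hx'0 : ∀ d, d ∉ Set.range ι → x' d = 0 := fun d hd =>
    Function.extend_apply' x _ d fun ⟨d', h⟩ => hd ⟨d', h⟩
  have hfeas : (I.augment y hpos).BCRFeasible r x' := by
    refine ⟨fun d => ?_, fun S hS hSR => ?_⟩
    · by_cases hd : d ∈ Set.range ι
      · obtain ⟨d, rfl⟩ := hd
        rw [hx'ι]
        exact hx.1 d
      · rw [hx'0 d hd]
    · refine (hx.2 S hS hSR).trans (le_of_eq ?_)
      rw [Finset.sum_filter, Finset.sum_filter]
      refine Fintype.sum_of_injective ι hι _ _ (fun d hd => ?_) fun d => ?_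
      · rw [hx'0 d hd, ite_self]
      · rw [hx'ι]
  refine ((I.augment y hpos).bcr_le hfeas).trans ?_
  have hsum : ∑ d : I.graph.Dart, I.augmentedCost y d.edge * x d =
      ∑ d : (I.augment y hpos).graph.Dart, (I.augment y hpos).cost d.edge * x' d := by
    refine Fintype.sum_of_injective ι hι _ _ (fun d hd => ?_) fun d => ?_
    · rw [hx'0 d hd, mul_zero]
    · rw [hx'ι]
      rfl
  rw [← hsum]
  exact Finset.sum_le_sum fun d _ =>
    mul_le_mul_of_nonneg_right (hy.augmentedCost_le d.edge_mem) (hx.1 d)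

/-! ### Comparison of the two suprema -/

/-- Below `HYP`, every value is dominated by `OPT` of an MST-optimal instance with the same
terminals and no larger value of the bidirected cut relaxation. -/
theorem exists_mstOptimal_of_lt_hyp {r : I.V} (hr : r ∈ I.terminals) {γ : ℝ} (hγ : γ < I.hyp r) :
    ∃ J : SteinerInstance, J.MSTOptimal ∧ γ ≤ J.opt ∧ 0 ≤ J.opt ∧
      ∀ s ∈ J.terminals, J.bcr s ≤ I.bcr r := by
  obtain ⟨y, hy, hlam, hsum, hsingle⟩ := I.exists_isLaminar_isHypDual_pos hr hγ
  have hpos := hy.augmentedCost_pos I hsingle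
  have hopt := hy.sum_le_opt_augment hr hpos
  have htmst := hy.tmst_augment_le_sum hlam hr hpos
  refine ⟨I.augment y hpos, (htmst.trans hopt).antisymm (I.augment y hpos).opt_le_tmst,
    hsum.trans hopt, (Finset.sum_nonneg fun S _ => hy.nonneg S).trans hopt, fun s hs => ?_⟩
  exact ((I.augment y hpos).bcr_le_bcr_of_root hr hs).trans (hy.bcr_augment_le hr hpos)

end SteinerInstance

end

/-- The supremum (in the extended reals) of `HYP / BCR` over all instances of Steiner Tree equals
the supremum of `OPT / BCR` over all MST-optimal instances, for an arbitrary choice of the root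
terminal used to write down the two relaxations in each instance. -/
theorem theorem4 (root : (I : SteinerInstance) → I.V)
    (root_mem : ∀ I : SteinerInstance, root I ∈ I.terminals) :
    sSup {q : EReal | ∃ I : SteinerInstance,
        q = ((I.hyp (root I) / I.bcr (root I) : ℝ) : EReal)} =
      sSup {q : EReal | ∃ I : SteinerInstance, I.MSTOptimal ∧
        q = ((I.opt / I.bcr (root I) : ℝ) : EReal)} := by
  apply le_antisymm
  · refine sSup_le ?_
    rintro q ⟨I, rfl⟩
    have hI := I.bcr_pos (root_mem I)
    by_contra! hlt
    obtain ⟨z, hz, hzq⟩ := EReal.lt_iff_exists_real_btwn.1 hlt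
    rw [EReal.coe_lt_coe_iff, lt_div_iff₀ hI] at hzq
    obtain ⟨J, hJ, hγ, hopt, hbcr⟩ := I.exists_mstOptimal_of_lt_hyp (root_mem I) hzq
    have hle : z ≤ J.opt / J.bcr (root J) :=
      calc z ≤ J.opt / I.bcr (root I) := (le_div_iff₀ hI).2 hγ
        _ ≤ J.opt / J.bcr (root J) :=
          div_le_div_of_nonneg_left hopt (J.bcr_pos (root_mem J)) (hbcr _ (root_mem J))
    exact (hz.trans_le (EReal.coe_le_coe_iff.2 hle)).not_ge (le_sSup ⟨J, hJ, rfl⟩)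
  · refine sSup_le ?_
    rintro q ⟨I, hI, rfl⟩
    refine le_sSup_of_le ⟨I, rfl⟩ (EReal.coe_le_coe_iff.2 ?_)
    exact div_le_div_of_nonneg_right
      (SteinerInstance.MSTOptimal.opt_le_hyp I hI (root_mem I)) (I.bcr_pos (root_mem I)).le
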